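/- **Arrival games.** For $B\subseteq\{R,S,1,2\}$, an instance of a generalised $B$-arrival problem is $G=(V,E,s,t,\{V_\sigma\}_{\sigma\in B},P,\mathit{Ord})$, where $(V,E)$ is a finite directed graph in which every vertex has at least one out-edge (self-loops allowed); $s,t\in V$ are the start and the target, and the only out-edge of $t$ is its self-loop; the sets $V_\sigma$ $(\sigma\in B)$, possibly empty, partition $V\setminus\{t\}$ into probabilistic ($R$), switching ($S$), max player ($1$) and min player ($2$) nodes, with $V_\sigma=\emptyset$ for $\sigma\notin B$; $P:V_R\times V\to[0,1]\cap\mathbb Q$ satisfies $\sum_w P(v,w)=1$, and $P(v,w)>0$ iff $(v,w)\in E$; and $\mathit{Ord}$ assigns to each $v\in V_S$ a finite sequence of vertices whose set of entries is exactly the set of out-neighbours of $v$. A state is a pair $(v,q)$ of a vertex $v$ and a function $q:V_S\to\mathbb N_0$ with $q(u)<|\mathit{Ord}(u)|$ for all $u\in V_S$; let $Q$ be the set of such functions. The play starts in $(s,q_0)$ with $q_0\equiv 0$. From $(v,q)$ with $v\in V_S$ it moves to $(\mathit{Ord}(v)_{q(v)},q')$, where $q'$ agrees with $q$ except that $q'(v)=q(v)+1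 \bmod |\mathit{Ord}(v)|$. From $v\in V_R$ the next vertex is $w$ with probability $P(v,w)$, from $v\in V_1$ (resp. $V_2$) it is an out-neighbour of $v$ chosen by player 1 (resp. 2), and from $t$ it is $t$; in these cases $q$ does not change. A strategy of player $i\in\{1,2\}$ is a function on $V_i\times Q$ that assigns to each $(v,q)$ an out-neighbour of $v$. Strategies $\sigma_1,\tau_2$ of the two players determine a probability measure $\mathbb P_{\sigma_1,\tau_2}$ on infinite plays, and $$\mathrm{val}(G)=\max_{\sigma_1}\min_{\tau_2}\mathbb P_{\sigma_1,\tau_2}(\text{the play visits } t).$$ $B$-Arrival-Qual-$0$ is the problem of deciding, given an instance $G$ of the generalised $B$-arrival problem, whether $\mathrm{val}(G)>0$; for $R\notin B$, $B$-Arrival is the problem of deciding whether $\mathrm{val}(G)=1$. Instances are given explicitly, with vertices and the numerators and denominators of probabilities written in binary, and out-neighbours and switching orders written as lists. **Theorem.** The three problems $\{R,S,1,2\}$-Arrival-Qual-$0$, $\{S,1,2\}$-Arrival and $\{R,S,2\}$-Arrival-Qual-$0$ are pairwise polynomial-time equivalent: each is reducible to each of the others by a many-one reduction that maps instances to instances and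 is computable in polynomial time by a Turing machine. -/

import Mathlib

open MeasureTheory ProbabilityTheory
open scoped ENNReal NNReal

/-! ## Generalised arrival games -/

/-- The four types of nodes: probabilistic, switching, max player and min player nodes. -/
inductive NodeType where
  | R | S | one | two
  deriving DecidableEq

/-- A generalised arrival game on a finite vertex set `V`. -/
structure ArrivalGame (V : Type) [Fintype V] where
  /-- The edges of the directed graph. -/
  E : Finset (V × V)
  /-- The start vertex. -/
  s : V
  /-- The target vertex. -/
  t : V
  exists_out : ∀ v, ∃ w, (v, w) ∈ E
  target_out : ∀ v, (t, v) ∈ E → v = t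
  /-- The partition of `V - {t}` into node types; the value `none` is taken exactly at `t`. -/
  kind : V → Option NodeType
  kind_eq_none_iff : ∀ v, kind v = none ↔ v = t
  /-- The (rational, non-negative) transition probabilities at the probabilistic nodes. -/
  P : {v : V // kind v = some NodeType.R} → V → ℚ≥0
  P_sum : ∀ v, ∑ w, P v w = 1
  P_pos_iff : ∀ v w, 0 < P v w ↔ (v.1, w) ∈ E
  /-- The switching order at the switching nodes. -/
  Ord : {v : V // kind v = some NodeType.S} → List V
  mem_Ord_iff : ∀ v w, w ∈ Ord v ↔ (v.1, w) ∈ E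

namespace ArrivalGame

variable {V : Type} [Fintype V] (G : ArrivalGame V)

theorem Ord_length_pos (v : {v : V // G.kind v = some NodeType.S}) : 0 < (G.Ord v).length := by
  obtain ⟨w, hw⟩ := G.exists_out v.1
  exact List.length_pos_of_mem ((G.mem_Ord_iff v w).2 hw)

/-- The set `Q` of switching positions: functions `q` on the switching nodes with
`q v < |Ord v|`. -/
abbrev Position : Type :=
  (v : {v : V // G.kind v = some NodeType.S}) → Fin (G.Ord v).length

/-- The position `q₀` which is identically zero. -/
def initialPosition : G.Position := fun v => ⟨0, G.Ord_length_pos v⟩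

/-- Advance the switching position at the switching node `v` by one, cyclically. -/
def advance [DecidableEq V] (v : {v : V // G.kind v = some NodeType.S}) (q : G.Position) :
    G.Position :=
  Function.update q v
    ⟨((q v : ℕ) + 1) % (G.Ord v).length, Nat.mod_lt _ (G.Ord_length_pos v)⟩

/-- The state space `V × Q`. -/
def State : Type := V × G.Position

instance : Finite G.State := inferInstanceAs (Finite (V × G.Position))

/-- The state space is finite and carries the discrete σ-algebra; the induced product σ-algebra
on sequences of states is the one generated by the basic cylinders. -/
instance : MeasurableSpace G.State := ⊤

/-- The initial state `(s, q₀)`. -/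
def initialState : G.State := (G.s, G.initialPosition)

/-- A deterministic strategy, positional on the state space, for the player who controls the nodes
of type `c`: at each state whose vertex has type `c` it selects an outgoing edge. -/
abbrev Strategy (c : NodeType) : Type :=
  (x : {v : V // G.kind v = some c} × G.Position) → {w : V // (x.1.1, w) ∈ G.E}

instance (c : NodeType) : Nonempty (G.Strategy c) :=
  ⟨fun x => ⟨(G.exists_out x.1.1).choose, (G.exists_out x.1.1).choose_spec⟩⟩

instance (c : NodeType) : Finite (G.Strategy c) := inferInstance

/-- The distribution of the next vertex at a probabilistic node. -/
noncomputable def nextVertex (v : {v : V // G.kind v = some NodeType.R}) : PMF V :=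
  PMF.ofFintype (fun w => (((G.P v w : ℚ≥0) : ℝ≥0) : ℝ≥0∞)) (by
    have h := G.P_sum v
    have h2 : ∑ w, ((G.P v w : ℚ≥0) : ℝ≥0) = 1 := by exact_mod_cast h
    exact_mod_cast h2)

/-- The distribution of the next state, under the strategies `σ` of player 1 and `τ` of
player 2. -/
noncomputable def step [DecidableEq V] (σ : G.Strategy NodeType.one) (τ : G.Strategy NodeType.two)
    (x : G.State) : PMF G.State :=
  match h : G.kind x.1 with
  | some NodeType.R => (G.nextVertex ⟨x.1, h⟩).map (fun w => (w, x.2))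
  | some NodeType.S => PMF.pure ((G.Ord ⟨x.1, h⟩).get (x.2 ⟨x.1, h⟩), G.advance ⟨x.1, h⟩ x.2)
  | some NodeType.one => PMF.pure ((σ (⟨x.1, h⟩, x.2)).1, x.2)
  | some NodeType.two => PMF.pure ((τ (⟨x.1, h⟩, x.2)).1, x.2)
  | none => PMF.pure x

/-- The transition kernel on states under the strategies `σ` and `τ`. -/
noncomputable def stepKernel [DecidableEq V] (σ : G.Strategy NodeType.one)
    (τ : G.Strategy NodeType.two) : Kernel G.State G.State where
  toFun x := (G.step σ τ x).toMeasure
  measurable' := measurable_from_top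

instance [DecidableEq V] (σ : G.Strategy NodeType.one) (τ : G.Strategy NodeType.two) :
    IsMarkovKernel (G.stepKernel σ τ) :=
  ⟨fun x => PMF.toMeasure.isProbabilityMeasure (G.step σ τ x)⟩

/-- The transition kernel at time `n`, as a kernel that depends on the last state of the history
up to time `n` only. -/
noncomputable def historyKernel [DecidableEq V] (σ : G.Strategy NodeType.one)
    (τ : G.Strategy NodeType.two) (n : ℕ) :
    Kernel (Finset.Iic n → G.State) G.State :=
  (G.stepKernel σ τ).comap (fun h => h ⟨n, Finset.mem_Iic.2 le_rfl⟩) (measurable_pi_apply _)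

instance [DecidableEq V] (σ : G.Strategy NodeType.one) (τ : G.Strategy NodeType.two) (n : ℕ) :
    IsMarkovKernel (G.historyKernel σ τ n) := by
  unfold historyKernel; infer_instance

/-- The probability measure `ℙ_{σ,τ}` on infinite sequences of states, started at `(s, q₀)`. -/
noncomputable def playMeasure [DecidableEq V] (σ : G.Strategy NodeType.one)
    (τ : G.Strategy NodeType.two) : Measure (ℕ → G.State) :=
  Kernel.traj (X := fun _ => G.State) (G.historyKernel σ τ) 0 (fun _ => G.initialState)

/-- The event that the target is reached. -/
def Reach : Set (ℕ → G.State) := {π | ∃ i, (π i).1 = G.t}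

/-- The value `max_σ min_τ ℙ_{σ,τ}(Reach)` of the game. -/
noncomputable def val [DecidableEq V] : ℝ≥0∞ :=
  ⨆ σ : G.Strategy NodeType.one, ⨅ τ : G.Strategy NodeType.two, G.playMeasure σ τ G.Reach

/-- The supremum and the infimum in the definition of the value are attained. -/
theorem val_attained [DecidableEq V] :
    ∃ σ : G.Strategy NodeType.one, (⨅ τ, G.playMeasure σ τ G.Reach) = G.val ∧
      ∃ τ : G.Strategy NodeType.two, G.playMeasure σ τ G.Reach = G.val := by
  obtain ⟨σ, hσ⟩ := exists_eq_ciSup_of_finite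
    (f := fun σ : G.Strategy NodeType.one => ⨅ τ, G.playMeasure σ τ G.Reach)
  obtain ⟨τ, hτ⟩ := exists_eq_ciInf_of_finite (f := fun τ => G.playMeasure σ τ G.Reach)
  exact ⟨σ, hσ, τ, hτ.trans hσ⟩

end ArrivalGame

/-! ## Instances and their encoding as words -/

/-- An instance of a generalised `B`-arrival problem: a game on the vertices `0, …, n - 1` all of
whose nodes, other than the target, have a type in `B`. -/
structure ArrivalInstance (B : Set NodeType) where
  /-- The number of vertices. -/
  n : ℕ
  /-- The game. -/
  game : ArrivalGame (Fin n)
  kind_mem : ∀ v c, game.kind v = some c → c ∈ B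

/-- The alphabet in which instances are written. -/
inductive ArrivalSymbol where
  | zero | one | comma | slash | bar
  | tagT | tagR | tagS | tagOne | tagTwo
  deriving DecidableEq

instance : Fintype ArrivalSymbol where
  elems := {.zero, .one, .comma, .slash, .bar, .tagT, .tagR, .tagS, .tagOne, .tagTwo}
  complete := by intro x; cases x <;> decide

namespace ArrivalEncoding

/-- A binary digit. -/
def bit : Bool → ArrivalSymbol
  | false => ArrivalSymbol.zero
  | true => ArrivalSymbol.one

/-- A natural number in binary. -/
def natCode (k : ℕ) : List ArrivalSymbol := (Computability.encodeNat k).map bit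

/-- A natural number in binary, followed by a comma. -/
def natItem (k : ℕ) : List ArrivalSymbol := natCode k ++ [ArrivalSymbol.comma]

/-- A non-negative rational as numerator and denominator in binary, followed by a comma. -/
def ratItem (p : ℚ≥0) : List ArrivalSymbol :=
  natCode p.num ++ ArrivalSymbol.slash :: natItem p.den

/-- A list of items, followed by a bar. -/
def block {α : Type} (item : α → List ArrivalSymbol) (l : List α) : List ArrivalSymbol :=
  l.flatMap item ++ [ArrivalSymbol.bar]

/-- The tag for the type of a vertex. -/
def tag : Option NodeType → ArrivalSymbol
  | none => ArrivalSymbol.tagT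
  | some NodeType.R => ArrivalSymbol.tagR
  | some NodeType.S => ArrivalSymbol.tagS
  | some NodeType.one => ArrivalSymbol.tagOne
  | some NodeType.two => ArrivalSymbol.tagTwo

/-- The description of a vertex: its type, the list of its out-neighbours, the list of the
probabilities of its outgoing edges, and its switching order. -/
abbrev Record : Type := Option NodeType × List ℕ × List ℚ≥0 × List ℕ

/-- The word for the description of a vertex. -/
def recordCode (r : Record) : List ArrivalSymbol :=
  tag r.1 :: (block natItem r.2.1 ++ (block ratItem r.2.2.1 ++ block natItem r.2.2.2))

variable {n : ℕ}

/-- The out-neighbours of a vertex in increasing order. -/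
def outList (G : ArrivalGame (Fin n)) (v : Fin n) : List (Fin n) :=
  (List.finRange n).filter (fun w => (v, w) ∈ G.E)

/-- The description of the vertex `v`: the probabilities are listed in the order of the
out-neighbours if `v` is a probabilistic node, and this list is empty otherwise; the last list is
empty if `v` is not a switching node. -/
def record (G : ArrivalGame (Fin n)) (v : Fin n) : Record :=
  (G.kind v,
   (outList G v).map Fin.val,
   (if h : G.kind v = some NodeType.R then (outList G v).map (G.P ⟨v, h⟩) else []),
   (if h : G.kind v = some NodeType.S then (G.Ord ⟨v, h⟩).map Fin.val else []))

/-- The word for a game: start, target, and then the descriptions of all vertices in order. -/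
def gameCode (G : ArrivalGame (Fin n)) : List ArrivalSymbol :=
  natItem G.s ++ (natItem G.t ++ (List.ofFn (record G)).flatMap recordCode)

/-! The encoding is injective. -/

/-- A code whose words can be split off uniquely from the front of any word. -/
def SelfDelimiting {α : Type} (c : α → List ArrivalSymbol) : Prop :=
  ∀ a b r r', c a ++ r = c b ++ r' → a = b ∧ r = r'

theorem SelfDelimiting.terminated {α : Type} {c : α → List ArrivalSymbol} {z : ArrivalSymbol}
    (hc : Function.Injective c) (hz : ∀ a, z ∉ c a) (a b : α) (r r' : List ArrivalSymbol)
    (h : c a ++ z :: r = c b ++ z :: r') : a = b ∧ r = r' := by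
  have key : ∀ (l l' : List ArrivalSymbol), z ∉ l → z ∉ l' →
      l ++ z :: r = l' ++ z :: r' → l = l' ∧ r = r' := by
    intro l
    induction l with
    | nil =>
      intro l' _ h' e
      cases l' with
      | nil => simpa using e
      | cons x l' => simp at e h'; exact absurd e.1 h'.1
    | cons y l ih =>
      intro l' h1 h' e
      cases l' with
      | nil => simp at e h1; exact absurd e.1.symm h1.1
      | cons x l' =>
        simp only [List.cons_append, List.cons.injEq, List.mem_cons, not_or] at e h1 h'
        obtain ⟨h2, h3⟩ := ih l' h1.2 h'.2 e.2
        exact ⟨by rw [e.1, h2], h3⟩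
  obtain ⟨h1, h2⟩ := key _ _ (hz a) (hz b) h
  exact ⟨hc h1, h2⟩

theorem bit_injective : Function.Injective bit := by
  intro a b; cases a <;> cases b <;> simp [bit]

theorem natCode_injective : Function.Injective natCode := by
  intro a b h
  have h2 : Computability.encodeNat a = Computability.encodeNat b :=
    List.map_injective_iff.2 bit_injective h
  rw [← Computability.decode_encodeNat a, h2, Computability.decode_encodeNat]

theorem mem_natCode {k : ℕ} {z : ArrivalSymbol} (h : z ∈ natCode k) :
    z = ArrivalSymbol.zero ∨ z = ArrivalSymbol.one := by
  obtain ⟨b, -, rfl⟩ := List.mem_map.1 h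
  cases b <;> simp [bit]

theorem natItem_selfDelimiting : SelfDelimiting natItem := by
  intro a b r r' h
  refine SelfDelimiting.terminated natCode_injective (z := ArrivalSymbol.comma) ?_ a b r r'
    (by simpa [natItem] using h)
  intro k hk
  simpa using mem_natCode hk

theorem ratItem_selfDelimiting : SelfDelimiting ratItem := by
  intro a b r r' h
  have h1 := SelfDelimiting.terminated natCode_injective (z := ArrivalSymbol.slash)
    (fun k hk => by simpa using mem_natCode hk) a.num b.num (natItem a.den ++ r)
    (natItem b.den ++ r') (by simpa [ratItem] using h)
  have h2 := natItem_selfDelimiting _ _ _ _ h1.2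
  exact ⟨NNRat.ext_num_den h1.1 h2.1, h2.2⟩

/-- A word that begins with a binary digit, a comma or a slash. -/
def StartsItem (l : List ArrivalSymbol) : Prop :=
  ∃ x l', l = x :: l' ∧ x ≠ ArrivalSymbol.bar

theorem startsItem_natCode_append (k : ℕ) (x : ArrivalSymbol) (l : List ArrivalSymbol)
    (hx : x ≠ ArrivalSymbol.bar) : StartsItem (natCode k ++ x :: l) := by
  cases h : natCode k with
  | nil => exact ⟨x, l, rfl, hx⟩
  | cons y m =>
    refine ⟨y, m ++ x :: l, rfl, ?_⟩
    have hy : y ∈ natCode k := by rw [h]; simp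
    rcases mem_natCode hy with e | e <;> simp [e]

theorem block_selfDelimiting {α : Type} {c : α → List ArrivalSymbol} (hc : SelfDelimiting c)
    (hs : ∀ a, StartsItem (c a)) : SelfDelimiting (block c) := by
  intro l
  induction l with
  | nil =>
    intro l' r r' h
    cases l' with
    | nil => simpa [block] using h
    | cons b l' =>
      obtain ⟨x, m, hx, hne⟩ := hs b
      simp only [block, List.flatMap_nil, List.flatMap_cons, hx] at h
      simp at h
      exact absurd h.1.symm hne
  | cons a l ih =>
    intro l' r r' h
    cases l' with
    | nil =>
      obtain ⟨x, m, hx, hne⟩ := hs a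
      simp only [block, List.flatMap_nil, List.flatMap_cons, hx] at h
      simp at h
      exact absurd h.1 hne
    | cons b l' =>
      have h1 := hc a b (block c l ++ r) (block c l' ++ r') (by simpa [block] using h)
      have h2 := ih l' r r' h1.2
      exact ⟨by rw [h1.1, h2.1], h2.2⟩

theorem tag_injective : Function.Injective tag := by
  rintro (_ | _ | _ | _ | _) (_ | _ | _ | _ | _) h <;> first | rfl | cases h

theorem recordCode_selfDelimiting : SelfDelimiting recordCode := by
  have hn : SelfDelimiting (block natItem) :=
    block_selfDelimiting natItem_selfDelimiting
      (fun k => startsItem_natCode_append k _ _ (by simp))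
  have hr : SelfDelimiting (block ratItem) :=
    block_selfDelimiting ratItem_selfDelimiting
      (fun p => startsItem_natCode_append p.num _ _ (by simp))
  rintro ⟨k, l1, l2, l3⟩ ⟨k', l1', l2', l3'⟩ r r' h
  simp only [recordCode, List.cons_append, List.append_assoc, List.cons.injEq] at h
  obtain ⟨h0, h⟩ := h
  obtain ⟨h1, h⟩ := hn _ _ _ _ h
  obtain ⟨h2, h⟩ := hr _ _ _ _ h
  obtain ⟨h3, h⟩ := hn _ _ _ _ h
  exact ⟨by rw [tag_injective h0, h1, h2, h3], h⟩

theorem flatMap_recordCode_injective :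
    Function.Injective (fun l : List Record => l.flatMap recordCode) := by
  intro l
  induction l with
  | nil =>
    intro l' h
    cases l' with
    | nil => rfl
    | cons b l' => simp [recordCode] at h
  | cons a l ih =>
    intro l' h
    cases l' with
    | nil => simp [recordCode] at h
    | cons b l' =>
      have h1 := recordCode_selfDelimiting a b _ _
        (by simpa only [List.flatMap_cons] using h)
      rw [h1.1, ih h1.2]

theorem record_injective {G G' : ArrivalGame (Fin n)} (hs : G.s = G'.s) (ht : G.t = G'.t)
    (hr : ∀ v, record G v = record G' v) : G = G' := by
  have hkind : G.kind = G'.kind := funext fun v => congrArg (fun r : Record => r.1) (hr v)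
  have hout : ∀ v, outList G v = outList G' v := fun v =>
    List.map_injective_iff.2 Fin.val_injective
      (congrArg (fun r : Record => r.2.1) (hr v))
  have mem_out : ∀ (H : ArrivalGame (Fin n)) v w, w ∈ outList H v ↔ (v, w) ∈ H.E := by
    intro H v w; simp [outList]
  have hE : G.E = G'.E := by
    ext ⟨v, w⟩; rw [← mem_out, ← mem_out, hout]
  have hp := fun v => congrArg (fun r : Record => r.2.2.1) (hr v)
  have ho := fun v => congrArg (fun r : Record => r.2.2.2) (hr v)
  simp only [record, hout] at hp ho
  cases G with
  | mk E s t eo tout kind kn P Psum Ppos Ord mO =>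
  cases G' with
  | mk E' s' t' eo' tout' kind' kn' P' Psum' Ppos' Ord' mO' =>
  dsimp only at hs ht hkind hE hp ho
  subst hs ht hkind hE
  have hP : P = P' := by
    funext v w
    by_cases hw : (v.1, w) ∈ E
    · have h := hp v.1
      rw [dif_pos v.2, dif_pos v.2] at h
      exact List.map_inj_left.1 h w ((mem_out _ v.1 w).2 hw)
    · have h1 : P v w = 0 := by
        by_contra hne; exact hw ((Ppos v w).1 (pos_iff_ne_zero.2 hne))
      have h2 : P' v w = 0 := by
        by_contra hne; exact hw ((Ppos' v w).1 (pos_iff_ne_zero.2 hne))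
      rw [h1, h2]
  have hO : Ord = Ord' := by
    funext v
    have h := ho v.1
    rw [dif_pos v.2, dif_pos v.2] at h
    exact List.map_injective_iff.2 Fin.val_injective h
  subst hP hO
  rfl

/-- The word for an instance. -/
def instanceCode {B : Set NodeType} (I : ArrivalInstance B) : List ArrivalSymbol :=
  gameCode I.game

theorem instanceCode_injective {B : Set NodeType} :
    Function.Injective (instanceCode (B := B)) := by
  rintro ⟨n, G, hG⟩ ⟨n', G', hG'⟩ h
  obtain ⟨hs, h⟩ := natItem_selfDelimiting _ _ _ _ h
  obtain ⟨ht, h⟩ := natItem_selfDelimiting _ _ _ _ h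
  have hl := flatMap_recordCode_injective h
  have hn : n = n' := by simpa using congrArg List.length hl
  subst hn
  have hr : ∀ v, record G v = record G' v := fun v => congrFun (List.ofFn_injective hl) v
  obtain rfl := record_injective (Fin.val_injective hs) (Fin.val_injective ht) hr
  rfl

end ArrivalEncoding

/-! ## Decision problems and polynomial-time reductions -/

/-- A decision problem: a type of instances, an injective encoding of them as words over a finite
alphabet, and the set of yes-instances. -/
structure DecisionProblem where
  /-- The type of instances. -/
  Inst : Type
  /-- The alphabet. -/
  Symbol : Type
  [symbolFintype : Fintype Symbol]
  /-- The encoding. -/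
  encode : Inst → List Symbol
  encode_injective : Function.Injective encode
  /-- The yes-instances. -/
  Yes : Inst → Prop

/-- Polynomial-time many-one reducibility: some map of instances that is computed by a
(multi-stack) Turing machine in polynomial time preserves and reflects yes-instances. -/
def PolyTimeReducible (A B : DecisionProblem) : Prop :=
  ∃ f : A.Inst → B.Inst,
    Nonempty (Turing.TM2ComputableInPolyTime A.encode B.encode f) ∧ ∀ I, A.Yes I ↔ B.Yes (f I)

/-- Polynomial-time equivalence: reducibility in both directions. -/
def PolyTimeEquivalent (A B : DecisionProblem) : Prop :=
  PolyTimeReducible A B ∧ PolyTimeReducible B A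

/-- `B`-Arrival-Qual-0: decide whether `val(G) > 0`. -/
noncomputable def ArrivalQual0 (B : Set NodeType) : DecisionProblem where
  Inst := ArrivalInstance B
  Symbol := ArrivalSymbol
  encode := ArrivalEncoding.instanceCode
  encode_injective := ArrivalEncoding.instanceCode_injective
  Yes I := 0 < I.game.val

/-- `B`-Arrival, a name used for `B` without probabilistic nodes: decide whether `val(G) = 1`. -/
noncomputable def Arrival (B : Set NodeType) : DecisionProblem where
  Inst := ArrivalInstance B
  Symbol := ArrivalSymbol
  encode := ArrivalEncoding.instanceCode
  encode_injective := ArrivalEncoding.instanceCode_injective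
  Yes I := I.game.val = 1

/-! Only the sign of the value matters, and the sign is a matter of graph reachability. Once both
strategies are fixed, the play is a Markov chain on the finite set `V × Q`, and it visits `t` with
positive probability iff some path of steps of positive probability leads from the initial state to
`t` (`playMeasure_reach_pos_iff`). Hence `val G > 0` iff the initial state lies in the attractor of
`t` for the coalition of player 1 and chance (`val_pos_iff`): inside, player 1 decreases the rank;
outside, player 2 has one strategy that never enters it.

In the attractor a node of type `R` and a node of type `1` obey the same rule: one good
out-neighbour suffices. So all these nodes may be given to player 1, or all to chance with arbitrary
positive probabilities, without changing the sign of the value (`SameArena.val_pos_iff`). Without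
probabilistic nodes the play is deterministic and the value is `0` or `1`, so `val = 1` means `val >
0` (`val_eq_one_iff`). Relabelling therefore gives every reduction.

For a machine, the work lies in writing probabilities. The values `2⁻ᵐ, 2⁻ᵐ, …, 2⁻¹` are positive,
sum to `1`, and have denominators whose binary words are zeros followed by a one, so unary counters
replace arithmetic (`machine_run`). `record_relabel` identifies the output with the code of the
relabelled game. -/

/-- The node has type `R` or `1`. -/
def IsFriendly (k : Option NodeType) : Prop :=
  k = some NodeType.R ∨ k = some NodeType.one

instance (k : Option NodeType) : Decidable (IsFriendly k) :=
  inferInstanceAs (Decidable (_ ∨ _))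

/-! ## A machine that relabels the nodes of types `R` and `1` -/

namespace ArrivalMachine

open ArrivalEncoding StateTransition
open Turing.TM2.Stmt

/-- The stacks: input and output, reversed output, and two unary counters. -/
inductive Stack where
  | io | rev | cnt | cnt'
  deriving DecidableEq

instance : Fintype Stack where
  elems := {.io, .rev, .cnt, .cnt'}
  complete := by intro x; cases x <;> decide

/-- The control states. -/
inductive Label where
  | copy | out | skip | first | next | move | back | reverse
  deriving DecidableEq

instance : Fintype Label where
  elems := {.copy, .out, .skip, .first, .next, .move, .back, .reverse}
  complete := by intro x; cases x <;> simp

/-- The type that replaces the types `R` and `1`. -/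
def newKind (gen : Bool) : NodeType := if gen then NodeType.R else NodeType.one

/-- The symbol is the tag of a node of type `R` or `1`. -/
def isFriendlyTag : Option ArrivalSymbol → Bool
  | some ArrivalSymbol.tagR => true
  | some ArrivalSymbol.tagOne => true
  | _ => false

/-- Statements of the machine. -/
abbrev Stm : Type :=
  Turing.TM2.Stmt (fun _ : Stack => ArrivalSymbol) Label (Option ArrivalSymbol)

/-- Forget the symbol that was read and continue at `l`. -/
def jump (l : Label) : Stm := load (fun _ => none) (goto fun _ => l)

/-- Write the symbol `x`. -/
def emit (x : ArrivalSymbol) (q : Stm) : Stm := push Stack.rev (fun _ => x) q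

/-- Read a symbol from the stack `k`. -/
def read (k : Stack) (q : Stm) : Stm := pop k (fun _ o => o) q

/-- Write the symbol that was read. -/
def echo (q : Stm) : Stm := push Stack.rev (fun v => v.getD ArrivalSymbol.bar) q

/-- The program. -/
def program (gen : Bool) : Label → Stm
  | Label.copy =>
    read Stack.io <|
      branch isFriendlyTag (emit (tag (some (newKind gen))) (jump Label.out)) <|
      branch Option.isSome (echo (jump Label.copy)) (jump Label.reverse)
  | Label.out =>
    read Stack.io <| echo <|
      branch (fun v => decide (v = some ArrivalSymbol.bar)) (jump Label.skip) <|
      branch (fun v => gen && decide (v = some ArrivalSymbol.comma))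
        (push Stack.cnt (fun _ => ArrivalSymbol.one) (jump Label.out)) (jump Label.out)
  | Label.skip =>
    read Stack.io <|
      branch (fun v => decide (v = some ArrivalSymbol.bar)) (jump Label.first) (jump Label.skip)
  | Label.first =>
    read Stack.cnt <|
      branch Option.isSome
        (emit ArrivalSymbol.one (emit ArrivalSymbol.slash (jump Label.move)))
        (emit ArrivalSymbol.bar (jump Label.copy))
  -- The extra zero makes up for the mark just removed: `first` writes `2⁻ᵐ` when `m` marks are left
  -- and `next` then writes `2⁻ᵐ` again, so the sum is `1`.
  | Label.next =>
    read Stack.cnt <|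
      branch Option.isSome
        (emit ArrivalSymbol.one (emit ArrivalSymbol.slash
          (emit ArrivalSymbol.zero (jump Label.move))))
        (emit ArrivalSymbol.bar (jump Label.copy))
  | Label.move =>
    read Stack.cnt <|
      branch Option.isSome
        (push Stack.cnt' (fun _ => ArrivalSymbol.one)
          (emit ArrivalSymbol.zero (jump Label.move)))
        (emit ArrivalSymbol.one (emit ArrivalSymbol.comma (jump Label.back)))
  | Label.back =>
    read Stack.cnt' <|
      branch Option.isSome
        (push Stack.cnt (fun _ => ArrivalSymbol.one) (jump Label.back))
        (jump Label.next)
  | Label.reverse =>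
    read Stack.rev <|
      branch Option.isSome
        (push Stack.io (fun v => v.getD ArrivalSymbol.bar) (jump Label.reverse)) halt

/-- The machine. -/
abbrev machine (gen : Bool) : Turing.FinTM2 where
  K := Stack
  k₀ := Stack.io
  k₁ := Stack.io
  Γ _ := ArrivalSymbol
  Λ := Label
  main := Label.copy
  σ := Option ArrivalSymbol
  initialState := none
  m := program gen

/-- The contents of the stacks. -/
def contents (i a c d : List ArrivalSymbol) : Stack → List ArrivalSymbol
  | Stack.io => i
  | Stack.rev => a
  | Stack.cnt => c
  | Stack.cnt' => d

section contents
variable (i a c d x : List ArrivalSymbol)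

@[simp] theorem update_io : Function.update (contents i a c d) Stack.io x = contents x a c d := by
  funext k; cases k <;> simp [contents, Function.update]
@[simp] theorem update_rev : Function.update (contents i a c d) Stack.rev x = contents i x c d := by
  funext k; cases k <;> simp [contents, Function.update]
@[simp] theorem update_cnt : Function.update (contents i a c d) Stack.cnt x = contents i a x d := by
  funext k; cases k <;> simp [contents, Function.update]
@[simp] theorem update_cnt' : Function.update (contents i a c d) Stack.cnt' x = contents i a c x := by
  funext k; cases k <;> simp [contents, Function.update]
@[simp] theorem contents_io : contents i a c d Stack.io = i := rfl
@[simp] theorem contents_rev : contents i a c d Stack.rev = a := rfl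
@[simp] theorem contents_cnt : contents i a c d Stack.cnt = c := rfl
@[simp] theorem contents_cnt' : contents i a c d Stack.cnt' = d := rfl

end contents

/-- Configurations of the machine. -/
abbrev Config : Type :=
  Turing.TM2.Cfg (fun _ : Stack => ArrivalSymbol) Label (Option ArrivalSymbol)

/-- The configuration with control state `l` and the given stacks. -/
def cfg (l : Label) (i a c d : List ArrivalSymbol) : Config := ⟨some l, none, contents i a c d⟩

/-- The configuration `y` is reached from `x` in at most `n` steps. -/
def Within (gen : Bool) (n : ℕ) (x y : Config) : Prop :=
  Nonempty (EvalsToInTime (Turing.TM2.step (program gen)) x (some y) n)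

variable {gen : Bool}

theorem Within.refl (x : Config) : Within gen 0 x x := ⟨EvalsToInTime.refl _ _⟩

theorem Within.trans {m n : ℕ} {x y z : Config} (h₁ : Within gen m x y)
    (h₂ : Within gen n y z) : Within gen (m + n) x z := by
  obtain ⟨h₁⟩ := h₁
  obtain ⟨h₂⟩ := h₂
  rw [add_comm]
  exact ⟨EvalsToInTime.trans _ _ _ _ _ _ h₁ h₂⟩

theorem Within.mono {m n : ℕ} {x y : Config} (h : Within gen m x y) (hmn : m ≤ n) :
    Within gen n x y := by
  obtain ⟨h⟩ := h
  exact ⟨⟨h.toEvalsTo, h.steps_le_m.trans hmn⟩⟩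

theorem Within.cast {m n : ℕ} {x y x' y' : Config} (h : Within gen m x' y') (hx : x' = x)
    (hy : y' = y) (hmn : m = n) : Within gen n x y :=
  hx ▸ hy ▸ hmn ▸ h

theorem Within.step {x y : Config} (h : Turing.TM2.step (program gen) x = some y) :
    Within gen 1 x y :=
  ⟨⟨⟨1, h⟩, le_rfl⟩⟩

theorem Within.cons {n : ℕ} {x y z : Config} (h₁ : Turing.TM2.step (program gen) x = some y)
    (h₂ : Within gen n y z) : Within gen (n + 1) x z := by
  rw [add_comm]
  exact (Within.step h₁).trans h₂

/-! ### Single steps of the machine. -/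

section steps
variable (i a c d : List ArrivalSymbol) (x : ArrivalSymbol)

theorem step_copy_friendly (hx : isFriendlyTag (some x) = true) :
    Turing.TM2.step (program gen) (cfg Label.copy (x :: i) a c d)
      = some (cfg Label.out i (tag (some (newKind gen)) :: a) c d) := by
  simp [cfg, program, read, emit, jump, hx]

theorem step_copy (hx : isFriendlyTag (some x) = false) :
    Turing.TM2.step (program gen) (cfg Label.copy (x :: i) a c d)
      = some (cfg Label.copy i (x :: a) c d) := by
  simp [cfg, program, read, echo, jump, hx]

theorem step_copy_nil :
    Turing.TM2.step (program gen) (cfg Label.copy [] a c d)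
      = some (cfg Label.reverse [] a c d) := by
  simp [cfg, program, read, jump, isFriendlyTag]

theorem step_out_bar :
    Turing.TM2.step (program gen) (cfg Label.out (ArrivalSymbol.bar :: i) a c d)
      = some (cfg Label.skip i (ArrivalSymbol.bar :: a) c d) := by
  simp [cfg, program, read, echo, jump]

/-- A comma ends one out-neighbour, so it adds one mark; if the new type is `1`, no marks are made
and the probability block will be empty. -/
theorem step_out_comma :
    Turing.TM2.step (program gen) (cfg Label.out (ArrivalSymbol.comma :: i) a c d)
      = some (cfg Label.out i (ArrivalSymbol.comma :: a)
          (List.replicate gen.toNat ArrivalSymbol.one ++ c) d) := by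
  cases gen <;> simp [cfg, program, read, echo, jump]

theorem step_out (h₁ : x ≠ ArrivalSymbol.bar) (h₂ : x ≠ ArrivalSymbol.comma) :
    Turing.TM2.step (program gen) (cfg Label.out (x :: i) a c d)
      = some (cfg Label.out i (x :: a) c d) := by
  simp [cfg, program, read, echo, jump, h₁, h₂]

theorem step_skip_bar :
    Turing.TM2.step (program gen) (cfg Label.skip (ArrivalSymbol.bar :: i) a c d)
      = some (cfg Label.first i a c d) := by
  simp [cfg, program, read, jump]

theorem step_skip (h₁ : x ≠ ArrivalSymbol.bar) :
    Turing.TM2.step (program gen) (cfg Label.skip (x :: i) a c d)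
      = some (cfg Label.skip i a c d) := by
  simp [cfg, program, read, jump, h₁]

theorem step_first_nil :
    Turing.TM2.step (program gen) (cfg Label.first i a [] d)
      = some (cfg Label.copy i (ArrivalSymbol.bar :: a) [] d) := by
  simp [cfg, program, read, emit, jump]

theorem step_first :
    Turing.TM2.step (program gen) (cfg Label.first i a (x :: c) d)
      = some (cfg Label.move i (ArrivalSymbol.slash :: ArrivalSymbol.one :: a) c d) := by
  simp [cfg, program, read, emit, jump]

theorem step_next_nil :
    Turing.TM2.step (program gen) (cfg Label.next i a [] d)
      = some (cfg Label.copy i (ArrivalSymbol.bar :: a) [] d) := by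
  simp [cfg, program, read, emit, jump]

theorem step_next :
    Turing.TM2.step (program gen) (cfg Label.next i a (x :: c) d)
      = some (cfg Label.move i
          (ArrivalSymbol.zero :: ArrivalSymbol.slash :: ArrivalSymbol.one :: a) c d) := by
  simp [cfg, program, read, emit, jump]

theorem step_move_nil :
    Turing.TM2.step (program gen) (cfg Label.move i a [] d)
      = some (cfg Label.back i (ArrivalSymbol.comma :: ArrivalSymbol.one :: a) [] d) := by
  simp [cfg, program, read, emit, jump]

theorem step_move :
    Turing.TM2.step (program gen) (cfg Label.move i a (x :: c) d)
      = some (cfg Label.move i (ArrivalSymbol.zero :: a) c (ArrivalSymbol.one :: d)) := by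
  simp [cfg, program, read, emit, jump]

theorem step_back_nil :
    Turing.TM2.step (program gen) (cfg Label.back i a c [])
      = some (cfg Label.next i a c []) := by
  simp [cfg, program, read, jump]

theorem step_back :
    Turing.TM2.step (program gen) (cfg Label.back i a c (x :: d))
      = some (cfg Label.back i a (ArrivalSymbol.one :: c) d) := by
  simp [cfg, program, read, jump]

theorem step_reverse_nil :
    Turing.TM2.step (program gen) (cfg Label.reverse i [] c d)
      = some ⟨none, none, contents i [] c d⟩ := by
  simp [cfg, program, read]

theorem step_reverse :
    Turing.TM2.step (program gen) (cfg Label.reverse i (x :: a) c d)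
      = some (cfg Label.reverse (x :: i) a c d) := by
  simp [cfg, program, read, jump]

end steps

/-! ### Runs of the machine within one control state. -/

theorem copy_run (w i a c d : List ArrivalSymbol)
    (hw : ∀ x ∈ w, isFriendlyTag (some x) = false) :
    Within gen w.length (cfg Label.copy (w ++ i) a c d) (cfg Label.copy i (w.reverse ++ a) c d) := by
  induction w generalizing a with
  | nil => exact Within.refl _
  | cons x w ih =>
    simp only [List.mem_cons, forall_eq_or_imp] at hw
    simpa using Within.cons (step_copy (w ++ i) a c d x hw.1) (ih (x :: a) hw.2)

theorem reverse_run (i a : List ArrivalSymbol) :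
    Within gen (a.length + 1) (cfg Label.reverse i a [] [])
      ⟨none, none, contents (a.reverse ++ i) [] [] []⟩ := by
  induction a generalizing i with
  | nil => exact Within.step (step_reverse_nil i [] [])
  | cons x a ih => simpa using Within.cons (step_reverse i a [] [] x) (ih (x :: i))

theorem out_run_natCode (w i a c d : List ArrivalSymbol)
    (hw : ∀ x ∈ w, x = ArrivalSymbol.zero ∨ x = ArrivalSymbol.one) :
    Within gen w.length (cfg Label.out (w ++ i) a c d) (cfg Label.out i (w.reverse ++ a) c d) := by
  induction w generalizing a with
  | nil => exact Within.refl _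
  | cons x w ih =>
    simp only [List.mem_cons, forall_eq_or_imp] at hw
    have h₁ : x ≠ ArrivalSymbol.bar := by rintro rfl; simp at hw
    have h₂ : x ≠ ArrivalSymbol.comma := by rintro rfl; simp at hw
    simpa using Within.cons (step_out (w ++ i) a c d x h₁ h₂) (ih (x :: a) hw.2)

/-- Digits are neither commas nor bars, so commas count the items and the first bar ends the block.
-/
theorem out_run (l : List ℕ) (i a c d : List ArrivalSymbol) :
    Within gen (block natItem l).length (cfg Label.out (block natItem l ++ i) a c d)
      (cfg Label.skip i ((block natItem l).reverse ++ a)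
        (List.replicate (gen.toNat * l.length) ArrivalSymbol.one ++ c) d) := by
  induction l generalizing a c with
  | nil => simpa [block] using Within.step (step_out_bar i a c d)
  | cons k l ih =>
    have h₁ := out_run_natCode (gen := gen) (natCode k)
      (ArrivalSymbol.comma :: (block natItem l ++ i)) a c d (fun x hx => mem_natCode hx)
    have h₂ := h₁.trans (Within.cons (step_out_comma _ _ _ _) (ih _ _))
    rw [← List.append_assoc (List.replicate _ _), List.replicate_append_replicate] at h₂
    have e : gen.toNat * l.length + gen.toNat = gen.toNat * (k :: l).length := by
      rw [List.length_cons, mul_add_one]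
    rw [e] at h₂
    refine h₂.cast ?_ ?_ ?_
    · simp [block, natItem]
    · simp [block, natItem]
    · simp [block, natItem, add_comm, add_left_comm]

theorem skip_run (w i a c d : List ArrivalSymbol) (hw : ∀ x ∈ w, x ≠ ArrivalSymbol.bar) :
    Within gen (w.length + 1) (cfg Label.skip (w ++ ArrivalSymbol.bar :: i) a c d)
      (cfg Label.first i a c d) := by
  induction w with
  | nil => exact Within.step (step_skip_bar i a c d)
  | cons x w ih =>
    simp only [List.mem_cons, forall_eq_or_imp] at hw
    simpa using Within.cons (step_skip (w ++ ArrivalSymbol.bar :: i) a c d x hw.1) (ih hw.2)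

/-- A counter with value `m`. -/
abbrev marks (m : ℕ) : List ArrivalSymbol := List.replicate m ArrivalSymbol.one

/-- Reading a unary counter destroys it, so each mark is saved on the second counter while its zero
is written; `back_run` restores it. The value `j` is general for the sake of the induction. -/
theorem move_run (m j : ℕ) (i a : List ArrivalSymbol) :
    Within gen (m + 1) (cfg Label.move i a (marks m) (marks j))
      (cfg Label.back i (ArrivalSymbol.comma :: ArrivalSymbol.one ::
        (List.replicate m ArrivalSymbol.zero ++ a)) [] (marks (j + m))) := by
  induction m generalizing j a with
  | zero => exact Within.step (step_move_nil i a (marks j))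
  | succ m ih =>
    have h := Within.cons (step_move i a (marks m) (marks j) ArrivalSymbol.one)
      (ih (j + 1) (ArrivalSymbol.zero :: a))
    refine h.cast rfl ?_ rfl
    rw [List.replicate_succ', Nat.add_right_comm j 1 m]
    simp [Nat.add_assoc]

theorem back_run (m j : ℕ) (i a : List ArrivalSymbol) :
    Within gen (m + 1) (cfg Label.back i a (marks j) (marks m))
      (cfg Label.next i a (marks (j + m)) []) := by
  induction m generalizing j with
  | zero => exact Within.step (step_back_nil i a (marks j))
  | succ m ih =>
    have h := Within.cons (step_back i a (marks j) (marks m) ArrivalSymbol.one) (ih (j + 1))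
    exact h.cast rfl (by rw [Nat.add_right_comm j 1 m, Nat.add_assoc]) rfl

/-! ### Writing dyadic probabilities. -/

/-- The list `2⁻ᵐ, …, 2⁻¹`. -/
def halves : ℕ → List ℚ≥0
  | 0 => []
  | m + 1 => (2 ^ (m + 1))⁻¹ :: halves m

/-- The list `2⁻ᵐ, 2⁻ᵐ, …, 2⁻¹` of length `m + 1`. -/
def dyadic : ℕ → List ℚ≥0
  | 0 => []
  | m + 1 => (2 ^ m)⁻¹ :: halves m

/-- Binary words begin with the least significant digit, so doubling prepends a zero. -/
theorem natCode_two_pow (m : ℕ) :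
    natCode (2 ^ m) = List.replicate m ArrivalSymbol.zero ++ [ArrivalSymbol.one] := by
  have h : ∀ m : ℕ, ∃ p : PosNum, ((2 ^ m : ℕ) : Num) = Num.pos p ∧
      Computability.encodePosNum p = List.replicate m false ++ [true] := by
    intro m
    induction m with
    | zero => exact ⟨1, by simp; rfl, rfl⟩
    | succ m ih =>
      obtain ⟨p, h₁, h₂⟩ := ih
      refine ⟨p.bit0, ?_, by simp [Computability.encodePosNum, h₂, List.replicate_succ]⟩
      rw [pow_succ, mul_two, Nat.cast_add, h₁]
      have : Num.bit0 (Num.pos p) = Num.pos p + Num.pos p := Num.bit0_of_bit0 _ |>.symm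
      rw [← this]; rfl
  obtain ⟨p, h₁, h₂⟩ := h m
  rw [natCode, Computability.encodeNat, h₁, Computability.encodeNum, h₂]
  simp [bit]

theorem ratItem_half_pow (m : ℕ) :
    ratItem (2 ^ m)⁻¹ = ArrivalSymbol.one :: ArrivalSymbol.slash ::
      (List.replicate m ArrivalSymbol.zero ++ [ArrivalSymbol.one, ArrivalSymbol.comma]) := by
  have e : (((2 ^ m)⁻¹ : ℚ≥0) : ℚ) = ((2 ^ m : ℕ) : ℚ)⁻¹ := by push_cast; rfl
  have hn : ((2 ^ m)⁻¹ : ℚ≥0).num = 1 := by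
    rw [← NNRat.natAbs_num_coe, e, Rat.inv_natCast_num_of_pos (by positivity)]; rfl
  have hd : ((2 ^ m)⁻¹ : ℚ≥0).den = 2 ^ m := by
    rw [← NNRat.den_coe, e, Rat.inv_natCast_den_of_pos (by positivity)]
  have h1 : natCode 1 = [ArrivalSymbol.one] := natCode_two_pow 0
  simp [ratItem, natItem, hn, hd, h1, natCode_two_pow]

theorem replicate_append_cons {α : Type} (m : ℕ) (x : α) (l : List α) :
    List.replicate m x ++ x :: l = x :: (List.replicate m x ++ l) := by
  induction m with
  | zero => rfl
  | succ m ih => rw [List.replicate_succ, List.cons_append, ih, List.cons_append]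

/-- The round that starts with `m + 1` marks takes `1 + (m + 1) + (m + 1) = (m + 2)² - (m + 1)²`
steps, so the rounds telescope to a square. -/
theorem next_run (m : ℕ) (i a : List ArrivalSymbol) :
    Within gen ((m + 1) ^ 2) (cfg Label.next i a (marks m) [])
      (cfg Label.copy i ((block ratItem (halves m)).reverse ++ a) [] []) := by
  induction m generalizing a with
  | zero => exact Within.step (step_next_nil i a [])
  | succ m ih =>
    have h₁ := Within.cons (step_next i a (marks m) [] ArrivalSymbol.one)
      (((move_run m 0 i _).trans (back_run (0 + m) 0 i _)).trans (by simpa using ih _))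
    refine h₁.cast rfl ?_ (by ring)
    simp [block, halves, ratItem_half_pow, List.replicate_succ, replicate_append_cons]

theorem first_run (k : ℕ) (i a : List ArrivalSymbol) :
    Within gen ((k + 1) ^ 2) (cfg Label.first i a (marks k) [])
      (cfg Label.copy i ((block ratItem (dyadic k)).reverse ++ a) [] []) := by
  cases k with
  | zero => exact Within.step (step_first_nil i a [])
  | succ m =>
    have h₁ := Within.cons (step_first (gen := gen) i a (marks m) [] ArrivalSymbol.one)
      (((move_run m 0 i _).trans (back_run (0 + m) 0 i _)).trans (by simpa using next_run m i _))
    refine h₁.cast rfl ?_ (by ring)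
    simp [block, dyadic, ratItem_half_pow]

/-- The effect of the machine on the description of a vertex. -/
def relabelRecord (gen : Bool) (r : Record) : Record :=
  if IsFriendly r.1 then
    (some (newKind gen), r.2.1, dyadic (gen.toNat * r.2.1.length), r.2.2.2)
  else r

theorem isFriendlyTag_tag (k : Option NodeType) :
    isFriendlyTag (some (tag k)) = true ↔ IsFriendly k := by
  rcases k with _ | _ | _ | _ | _ <;> simp [isFriendlyTag, tag, IsFriendly]

theorem isFriendlyTag_natCode {k : ℕ} {x : ArrivalSymbol} (hx : x ∈ natCode k) :
    isFriendlyTag (some x) = false := by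
  rcases mem_natCode hx with rfl | rfl <;> rfl

theorem ne_bar_of_mem_natCode {k : ℕ} {x : ArrivalSymbol} (hx : x ∈ natCode k) :
    x ≠ ArrivalSymbol.bar := by
  rcases mem_natCode hx with rfl | rfl <;> simp

theorem isFriendlyTag_natItem {k : ℕ} {x : ArrivalSymbol} (hx : x ∈ natItem k) :
    isFriendlyTag (some x) = false := by
  rcases List.mem_append.1 hx with h | h
  · exact isFriendlyTag_natCode h
  · rw [List.mem_singleton.1 h]; rfl

theorem isFriendlyTag_ratItem {p : ℚ≥0} {x : ArrivalSymbol} (hx : x ∈ ratItem p) :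
    isFriendlyTag (some x) = false := by
  rcases List.mem_append.1 hx with h | h
  · exact isFriendlyTag_natCode h
  · rcases List.mem_cons.1 h with rfl | h
    · rfl
    · exact isFriendlyTag_natItem h

theorem ne_bar_of_mem_ratItem {p : ℚ≥0} {x : ArrivalSymbol} (hx : x ∈ ratItem p) :
    x ≠ ArrivalSymbol.bar := by
  simp only [ratItem, natItem, List.mem_append, List.mem_cons] at hx
  rcases hx with h | rfl | h | h
  · exact ne_bar_of_mem_natCode h
  · simp
  · exact ne_bar_of_mem_natCode h
  · rcases h with rfl | h
    · simp
    · simp at h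

theorem isFriendlyTag_block {α : Type} {c : α → List ArrivalSymbol}
    (hc : ∀ a, ∀ x ∈ c a, isFriendlyTag (some x) = false) (l : List α) :
    ∀ x ∈ block c l, isFriendlyTag (some x) = false := by
  intro x hx
  rcases List.mem_append.1 hx with h | h
  · obtain ⟨a, -, h⟩ := List.mem_flatMap.1 h
    exact hc a x h
  · rw [List.mem_singleton.1 h]; rfl

theorem length_le_length_block {α : Type} (c : α → List ArrivalSymbol)
    (hc : ∀ a, c a ≠ []) (l : List α) : l.length + 1 ≤ (block c l).length := by
  induction l with
  | nil => simp [block]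
  | cons a l ih =>
    have := List.length_pos_of_ne_nil (hc a)
    simp [block] at ih ⊢
    omega

/-- Reading and copying account for the linear term, the counter loops for the square. The old
probability block is discarded whatever it contains. -/
theorem relabelRecord_run (r : Record) (i a : List ArrivalSymbol) :
    Within gen ((recordCode r).length + (recordCode r).length ^ 2)
      (cfg Label.copy (recordCode r ++ i) a [] [])
      (cfg Label.copy i ((recordCode (relabelRecord gen r)).reverse ++ a) [] []) := by
  obtain ⟨k, l₁, l₂, l₃⟩ := r
  have h₃ : ∀ x ∈ block natItem l₃, isFriendlyTag (some x) = false :=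
    isFriendlyTag_block (fun _ _ => isFriendlyTag_natItem) l₃
  by_cases hk : IsFriendly k
  · have s₀ := Within.step (gen := gen)
      (step_copy_friendly (block natItem l₁ ++ (block ratItem l₂ ++ (block natItem l₃ ++ i)))
        a [] [] (tag k) ((isFriendlyTag_tag k).2 hk))
    have s₁ := s₀.trans (out_run l₁ _ _ [] [])
    have s₂ := skip_run (gen := gen) (l₂.flatMap ratItem) (block natItem l₃ ++ i)
      ((block natItem l₁).reverse ++ tag (some (newKind gen)) :: a)
      (marks (gen.toNat * l₁.length)) [] (fun x hx => by
        obtain ⟨p, -, h⟩ := List.mem_flatMap.1 hx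
        exact ne_bar_of_mem_ratItem h)
    have s₃ := s₂.trans (first_run _ _ _)
    have s₄ := s₃.trans (copy_run (block natItem l₃) i _ [] [] h₃)
    have e₂ : l₂.flatMap ratItem ++ ArrivalSymbol.bar :: (block natItem l₃ ++ i) =
        block ratItem l₂ ++ (block natItem l₃ ++ i) := by simp [block]
    rw [e₂] at s₄
    rw [List.append_nil] at s₁
    refine ((s₁.trans s₄).cast (n := _) ?_ ?_ rfl).mono ?_
    · simp [recordCode]
    · simp [recordCode, relabelRecord, hk]
    · have h := length_le_length_block natItem (fun k => by simp [natItem]) l₁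
      -- Every out-neighbour and the final bar occupy at least one symbol, so the counter is shorter
      -- than the block it was read from.
      have hg : gen.toNat * l₁.length + 1 ≤ (block natItem l₁).length := by
        cases gen <;> simp <;> omega
      have hb : (block ratItem l₂).length = (l₂.flatMap ratItem).length + 1 := by simp [block]
      simp only [recordCode, List.length_cons, List.length_append, hb]
      have := Nat.pow_le_pow_left (hg.trans (show (block natItem l₁).length ≤
        (block natItem l₁).length +
          ((l₂.flatMap ratItem).length + 1 + (block natItem l₃).length) + 1 by omega)) 2
      omega
  · have hr : relabelRecord gen (k, l₁, l₂, l₃) = (k, l₁, l₂, l₃) := by simp [relabelRecord, hk]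
    rw [hr]
    refine (copy_run _ i a [] [] ?_).mono (Nat.le_add_right _ _)
    intro x hx
    simp only [recordCode, List.mem_cons, List.mem_append] at hx
    rcases hx with rfl | hx | hx | hx
    · simpa using mt (isFriendlyTag_tag k).1 hk
    · exact isFriendlyTag_block (fun _ _ => isFriendlyTag_natItem) l₁ x hx
    · exact isFriendlyTag_block (fun _ _ => isFriendlyTag_ratItem) l₂ x hx
    · exact h₃ x hx

/-! ### Length of the output and total running time. -/

theorem length_flatMap_halves (m : ℕ) :
    ((halves m).flatMap ratItem).length ≤ m ^ 2 + 4 * m := by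
  induction m with
  | zero => simp [halves]
  | succ m ih =>
    simp only [halves, List.flatMap_cons, ratItem_half_pow, List.length_append, List.length_cons,
      List.length_replicate, List.length_nil]
    nlinarith

theorem length_block_dyadic (k : ℕ) :
    (block ratItem (dyadic k)).length ≤ k ^ 2 + 4 * k + 1 := by
  cases k with
  | zero => simp [dyadic, block]
  | succ m =>
    have := length_flatMap_halves m
    simp only [block, dyadic, List.flatMap_cons, ratItem_half_pow, List.length_append,
      List.length_cons, List.length_replicate, List.length_nil]
    nlinarith

theorem length_recordCode_relabelRecord (r : Record) :
    (recordCode (relabelRecord gen r)).length ≤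
      3 * (recordCode r).length + (recordCode r).length ^ 2 := by
  obtain ⟨k, l₁, l₂, l₃⟩ := r
  by_cases hk : IsFriendly k
  · simp only [relabelRecord, hk, if_true]
    have h := length_le_length_block natItem (fun k => by simp [natItem]) l₁
    have hg : gen.toNat * l₁.length + 1 ≤ (block natItem l₁).length := by
      cases gen <;> simp <;> omega
    have hd := length_block_dyadic (gen.toNat * l₁.length)
    simp only [recordCode, List.length_cons, List.length_append]
    generalize gen.toNat * l₁.length = n at *
    generalize (block natItem l₁).length = x at *
    generalize (block ratItem l₂).length = y at *
    generalize (block natItem l₃).length = z at *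
    -- The new probability block has length at most `n² + 4n + 1 = (n + 1)² + 2n`.
    have := Nat.pow_le_pow_left (show n + 1 ≤ x + (y + z) + 1 by omega) 2
    nlinarith
  · have hr : relabelRecord gen (k, l₁, l₂, l₃) = (k, l₁, l₂, l₃) := by simp [relabelRecord, hk]
    rw [hr]; omega

/-- The bound `x + x²` is superadditive, so the bounds for the single records add up to the bound
for the whole word. -/
theorem relabel_run (L : List Record) (i a : List ArrivalSymbol) :
    Within gen ((L.flatMap recordCode).length + (L.flatMap recordCode).length ^ 2)
      (cfg Label.copy (L.flatMap recordCode ++ i) a [] [])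
      (cfg Label.copy i (((L.map (relabelRecord gen)).flatMap recordCode).reverse ++ a) [] []) := by
  induction L generalizing a with
  | nil => exact Within.refl _
  | cons r L ih =>
    refine (((relabelRecord_run r _ a).trans (ih _)).cast (n := _) ?_ ?_ rfl).mono ?_
    · simp
    · simp
    · simp only [List.flatMap_cons, List.length_append]
      nlinarith

theorem length_relabel (L : List Record) :
    ((L.map (relabelRecord gen)).flatMap recordCode).length ≤
      3 * (L.flatMap recordCode).length + (L.flatMap recordCode).length ^ 2 := by
  induction L with
  | nil => simp
  | cons r L ih =>
    have := length_recordCode_relabelRecord (gen := gen) r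
    simp only [List.map_cons, List.flatMap_cons, List.length_append]
    nlinarith

/-- The machine rewrites the descriptions of the vertices and keeps the start and the target. -/
theorem machine_run (s t : ℕ) (L : List Record) (w : List ArrivalSymbol)
    (hw : w = natItem s ++ (natItem t ++ L.flatMap recordCode)) :
    Within gen (2 * w.length ^ 2 + 4 * w.length + 2) (cfg Label.copy w [] [] [])
      ⟨none, none, contents (natItem s ++ (natItem t ++
        (L.map (relabelRecord gen)).flatMap recordCode)) [] [] []⟩ := by
  have h₁ := copy_run (gen := gen) (natItem s) (natItem t ++ (L.flatMap recordCode ++ [])) [] [] []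
    (fun _ => isFriendlyTag_natItem)
  have h₂ := h₁.trans (copy_run (natItem t) _ _ [] [] (fun _ => isFriendlyTag_natItem))
  have h₃ := h₂.trans (relabel_run L [] _)
  have h₄ := h₃.trans (Within.step (step_copy_nil _ [] []))
  have h₅ := h₄.trans (reverse_run [] _)
  refine (h₅.cast (n := _) ?_ ?_ rfl).mono ?_
  · simp [hw]
  · simp
  -- The pass over the input costs at most `|w| + |w|²` steps, reversing the output at most `3|w| +
  -- |w|²`, and two steps change or end the phases.
  · have := length_relabel (gen := gen) L
    simp only [hw, List.length_append, List.length_reverse, List.length_nil]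
    nlinarith

theorem initList_machine (w : List ArrivalSymbol) :
    Turing.initList (machine gen) w = cfg Label.copy w [] [] [] := by
  refine congrArg (Turing.TM2.Cfg.mk _ _) (funext fun k => ?_)
  cases k <;> rfl

theorem haltList_machine (w : List ArrivalSymbol) :
    Turing.haltList (machine gen) w = ⟨none, none, contents w [] [] []⟩ := by
  refine congrArg (Turing.TM2.Cfg.mk _ _) (funext fun k => ?_)
  cases k <;> rfl

theorem outputsInTime {w w' : List ArrivalSymbol} {n : ℕ}
    (h : Within gen n (cfg Label.copy w [] [] []) ⟨none, none, contents w' [] [] []⟩) :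
    Nonempty (Turing.TM2OutputsInTime (machine gen) w (some w') n) := by
  rw [← initList_machine (gen := gen), ← haltList_machine (gen := gen)] at h
  exact h

/-- A map of instances that relabels the description of every vertex is computable in polynomial
time. -/
theorem nonempty_computable {A B : Type} (ea : A → List ArrivalSymbol)
    (eb : B → List ArrivalSymbol) (f : A → B)
    (h : ∀ a, ∃ (s t : ℕ) (L : List Record), ea a = natItem s ++ (natItem t ++ L.flatMap recordCode) ∧
      eb (f a) = natItem s ++ (natItem t ++ (L.map (relabelRecord gen)).flatMap recordCode)) :
    Nonempty (Turing.TM2ComputableInPolyTime ea eb f) := by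
  refine ⟨{ tm := machine gen
            inputAlphabet := Equiv.refl ArrivalSymbol
            outputAlphabet := Equiv.refl ArrivalSymbol
            time := 2 * Polynomial.X ^ 2 + 4 * Polynomial.X + 2
            outputsFun := fun a => Classical.choice ?_ }⟩
  obtain ⟨s, t, L, h₁, h₂⟩ := h a
  have hr := machine_run (gen := gen) s t L (ea a) h₁
  rw [← h₂] at hr
  have e : (2 * Polynomial.X ^ 2 + 4 * Polynomial.X + 2 : Polynomial ℕ).eval (ea a).length =
      2 * (ea a).length ^ 2 + 4 * (ea a).length + 2 := by simp
  have hid : ∀ l, List.map (Equiv.refl ArrivalSymbol).invFun l = l := List.map_id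
  rw [e, hid, hid]
  exact outputsInTime hr

end ArrivalMachine

/-! ## The value and the attractor of the target -/

namespace ArrivalGame

open Relation

/-- The games `G` and `G'` differ only in the ownership of nodes of types `R` and `1` and in their
probabilities. -/
structure SameArena {V : Type} [Fintype V] (G G' : ArrivalGame V) : Prop where
  E : G.E = G'.E
  s : G.s = G'.s
  t : G.t = G'.t
  kind : ∀ v, G.kind v = G'.kind v ∨ (IsFriendly (G.kind v) ∧ IsFriendly (G'.kind v))
  Ord : ∀ v h h', G.Ord ⟨v, h⟩ = G'.Ord ⟨v, h'⟩


section SameArena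
variable {V : Type} [Fintype V] {G G' : ArrivalGame V}

theorem SameArena.symm (h : SameArena G G') : SameArena G' G where
  E := h.E.symm
  s := h.s.symm
  t := h.t.symm
  kind v := (h.kind v).imp Eq.symm And.symm
  Ord v h₁ h₂ := (h.Ord v h₂ h₁).symm

theorem SameArena.kind_eq (h : SameArena G G') {v : V} {c : NodeType}
    (hv : G.kind v = some c) (hc : ¬ IsFriendly (some c)) : G'.kind v = some c := by
  rcases h.kind v with e | e
  · rw [← e, hv]
  · rw [hv] at e; exact absurd e.1 hc

theorem SameArena.isFriendly (h : SameArena G G') {v : V}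
    (hv : IsFriendly (G.kind v)) : IsFriendly (G'.kind v) := by
  rcases h.kind v with e | e
  · rwa [← e]
  · exact e.2

end SameArena

variable {V : Type} [Fintype V] [DecidableEq V] (G : ArrivalGame V)

instance : DiscreteMeasurableSpace G.State := ⟨fun _ => trivial⟩

/-! ### Positive probability of reaching the target as reachability in a graph. -/

section law
variable (σ : G.Strategy NodeType.one) (τ : G.Strategy NodeType.two)

instance : IsProbabilityMeasure (G.playMeasure σ τ) := by
  unfold playMeasure; infer_instance

/-- The distribution of the state at time `i`. -/
noncomputable def law (i : ℕ) : Measure G.State := (G.playMeasure σ τ).map (fun π => π i)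

instance (i : ℕ) : IsProbabilityMeasure (G.law σ τ i) :=
  Measure.isProbabilityMeasure_map (measurable_pi_apply i).aemeasurable

theorem law_zero : G.law σ τ 0 = Measure.dirac G.initialState := by
  have h := Kernel.traj_map_frestrictLe_apply (X := fun _ => G.State)
    (κ := G.historyKernel σ τ) 0 0 (fun _ => G.initialState)
  rw [Kernel.partialTraj_self, Kernel.id_apply] at h
  have h2 := congrArg (Measure.map
    (fun x : (Finset.Iic 0 → G.State) => x ⟨0, Finset.mem_Iic.2 le_rfl⟩)) h
  rw [Measure.map_map (measurable_pi_apply _) (by fun_prop),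
    Measure.map_dirac' (measurable_pi_apply _)] at h2
  exact h2

/-- This is the Markov property: split the trajectory measure at time `i`; given the history, the
next coordinate is distributed by `historyKernel`, which sees only the last state. -/
theorem law_succ (i : ℕ) : G.law σ τ (i + 1) = (G.law σ τ i).bind (G.stepKernel σ τ) := by
  have h := Kernel.traj_comp_partialTraj (X := fun _ => G.State)
    (κ := G.historyKernel σ τ) (Nat.zero_le i)
  have h₀ : G.playMeasure σ τ = (Kernel.partialTraj (X := fun _ => G.State)
      (G.historyKernel σ τ) 0 i (fun _ => G.initialState)).bind
        (Kernel.traj (X := fun _ => G.State) (G.historyKernel σ τ) i) := by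
    rw [playMeasure, ← h, Kernel.comp_apply]
  have hl : G.law σ τ i = (Kernel.partialTraj (X := fun _ => G.State)
      (G.historyKernel σ τ) 0 i (fun _ => G.initialState)).map
        (fun x => x ⟨i, Finset.mem_Iic.2 le_rfl⟩) := by
    rw [← Kernel.traj_map_frestrictLe_apply,
      Measure.map_map (measurable_pi_apply _) (by fun_prop)]
    rfl
  refine Measure.ext fun A _ => ?_
  have hA : MeasurableSet A := .of_discrete
  rw [law, Measure.map_apply (measurable_pi_apply (i + 1)) hA, h₀,
    Measure.bind_apply (measurable_pi_apply (i + 1) hA) (Kernel.aemeasurable _),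
    Measure.bind_apply hA (Kernel.aemeasurable _), hl,
    lintegral_map (Kernel.measurable_coe _ hA) (measurable_pi_apply _)]
  refine lintegral_congr fun x => ?_
  have hs := Kernel.map_traj_succ_self (X := fun _ => G.State)
    (κ := G.historyKernel σ τ) (a := i)
  have hx := DFunLike.congr_fun hs x
  have hm : Measurable fun π : ℕ → G.State => π (i + 1) := measurable_pi_apply (i + 1)
  rw [Kernel.map_apply _ hm] at hx
  have hxA := congrArg (fun μ : Measure G.State => μ A) hx
  rw [Measure.map_apply hm hA] at hxA
  exact hxA

/-- The step relation of positive probability. -/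
def Succ (x y : G.State) : Prop := G.step σ τ x y ≠ 0

/-- On a countable discrete space an integral of a nonnegative function is nonzero iff the function
is nonzero at some atom of positive mass. -/
theorem law_succ_ne_zero_iff (i : ℕ) (y : G.State) :
    G.law σ τ (i + 1) {y} ≠ 0 ↔ ∃ x, G.law σ τ i {x} ≠ 0 ∧ G.Succ σ τ x y := by
  have hk : ∀ x, G.stepKernel σ τ x {y} = G.step σ τ x y := fun x =>
    PMF.toMeasure_apply_singleton _ _ (measurableSet_singleton y)
  rw [law_succ, Measure.bind_apply (measurableSet_singleton y) (Kernel.aemeasurable _), ne_eq,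
    lintegral_eq_zero_iff (Kernel.measurable_coe _ (measurableSet_singleton y)),
    Filter.EventuallyEq, ae_iff_of_countable]
  simp [hk, Succ]

theorem exists_law_ne_zero_iff (x : G.State) :
    (∃ i, G.law σ τ i {x} ≠ 0) ↔ ReflTransGen (G.Succ σ τ) G.initialState x := by
  constructor
  · rintro ⟨i, hi⟩
    induction i generalizing x with
    | zero =>
      rw [law_zero] at hi
      have : x = G.initialState := by
        by_contra hne
        exact hi (by simp [Ne.symm hne])
      rw [this]
    | succ i ih =>
      obtain ⟨z, hz, hzx⟩ := (G.law_succ_ne_zero_iff σ τ i x).1 hi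
      exact (ih z hz).tail hzx
  · intro h
    induction h with
    | refl => exact ⟨0, by simp [law_zero]⟩
    | tail _ h ih =>
      obtain ⟨i, hi⟩ := ih
      exact ⟨i + 1, (G.law_succ_ne_zero_iff σ τ i _).2 ⟨_, hi, h⟩⟩

theorem law_singleton (i : ℕ) (x : G.State) :
    G.law σ τ i {x} = G.playMeasure σ τ {π | π i = x} := by
  rw [law, Measure.map_apply (measurable_pi_apply i) (measurableSet_singleton x)]
  rfl

/-- `Reach` is a countable union of events `π i = x`, and such a union is null iff all its members
are. -/
theorem playMeasure_reach_ne_zero_iff :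
    G.playMeasure σ τ G.Reach ≠ 0 ↔ ∃ i, ∃ x : G.State, x.1 = G.t ∧ G.law σ τ i {x} ≠ 0 := by
  have h : G.Reach = ⋃ i : ℕ, ⋃ x : {x : G.State // x.1 = G.t}, {π | π i = x.1} := by
    ext π
    simp [Reach]
  rw [h, ne_eq, measure_iUnion_null_iff]
  simp only [measure_iUnion_null_iff, ← law_singleton]
  simp

theorem playMeasure_reach_pos_iff :
    0 < G.playMeasure σ τ G.Reach ↔
      ∃ x : G.State, ReflTransGen (G.Succ σ τ) G.initialState x ∧ x.1 = G.t := by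
  rw [pos_iff_ne_zero, playMeasure_reach_ne_zero_iff]
  simp only [← exists_law_ne_zero_iff]
  constructor
  · rintro ⟨i, x, hx, h⟩
    exact ⟨x, ⟨i, h⟩, hx⟩
  · rintro ⟨x, ⟨i, h⟩, hx⟩
    exact ⟨i, x, hx, h⟩

end law

theorem pure_apply_ne_zero_iff {α : Type} (a b : α) : PMF.pure a b ≠ 0 ↔ b = a := by
  rw [← PMF.mem_support_iff, PMF.mem_support_pure_iff]

theorem map_apply_ne_zero_iff {α β : Type} (p : PMF α) (f : α → β) (b : β) :
    p.map f b ≠ 0 ↔ ∃ a, p a ≠ 0 ∧ f a = b := by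
  rw [← PMF.mem_support_iff, PMF.mem_support_map_iff]
  rfl

/-! ### Successors of a state by the type of its vertex. -/

section step
variable {G} {σ : G.Strategy NodeType.one} {τ : G.Strategy NodeType.two} {x y : G.State}

/-- Here the numerical values of `P` drop out: by `P_pos_iff` its support is the set of
out-neighbours. -/
theorem succ_iff_of_R (h : G.kind x.1 = some NodeType.R) :
    G.Succ σ τ x y ↔ (x.1, y.1) ∈ G.E ∧ y.2 = x.2 := by
  have hs : G.step σ τ x = (G.nextVertex ⟨x.1, h⟩).map (fun w => (w, x.2)) := by
    unfold step
    split <;> rename_i h' <;> first | rfl | exact absurd (h.symm.trans h') (by simp)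
  have hn : ∀ w, G.nextVertex ⟨x.1, h⟩ w ≠ 0 ↔ (x.1, w) ∈ G.E := by
    intro w
    rw [← G.P_pos_iff ⟨x.1, h⟩ w, pos_iff_ne_zero]
    simp [nextVertex]
  rw [Succ, hs]
  refine (map_apply_ne_zero_iff _ _ _).trans ?_
  simp only [hn]
  constructor
  · rintro ⟨w, hw, rfl⟩
    exact ⟨hw, rfl⟩
  · rintro ⟨hw, h2⟩
    exact ⟨y.1, hw, by rw [← h2]; rfl⟩

theorem succ_iff_of_S (h : G.kind x.1 = some NodeType.S) :
    G.Succ σ τ x y ↔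
      y = ((G.Ord ⟨x.1, h⟩).get (x.2 ⟨x.1, h⟩), G.advance ⟨x.1, h⟩ x.2) := by
  have hs : G.step σ τ x =
      PMF.pure ((G.Ord ⟨x.1, h⟩).get (x.2 ⟨x.1, h⟩), G.advance ⟨x.1, h⟩ x.2) := by
    unfold step
    split <;> rename_i h' <;> first | rfl | exact absurd (h.symm.trans h') (by simp)
  rw [Succ, hs]
  exact pure_apply_ne_zero_iff _ _

theorem succ_iff_of_one (h : G.kind x.1 = some NodeType.one) :
    G.Succ σ τ x y ↔ y = ((σ (⟨x.1, h⟩, x.2)).1, x.2) := by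
  have hs : G.step σ τ x = PMF.pure ((σ (⟨x.1, h⟩, x.2)).1, x.2) := by
    unfold step
    split <;> rename_i h' <;> first | rfl | exact absurd (h.symm.trans h') (by simp)
  rw [Succ, hs]
  exact pure_apply_ne_zero_iff _ _

theorem succ_iff_of_two (h : G.kind x.1 = some NodeType.two) :
    G.Succ σ τ x y ↔ y = ((τ (⟨x.1, h⟩, x.2)).1, x.2) := by
  have hs : G.step σ τ x = PMF.pure ((τ (⟨x.1, h⟩, x.2)).1, x.2) := by
    unfold step
    split <;> rename_i h' <;> first | rfl | exact absurd (h.symm.trans h') (by simp)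
  rw [Succ, hs]
  exact pure_apply_ne_zero_iff _ _

theorem succ_iff_of_none (h : G.kind x.1 = none) : G.Succ σ τ x y ↔ y = x := by
  have hs : G.step σ τ x = PMF.pure x := by
    unfold step
    split <;> rename_i h' <;> first | rfl | exact absurd (h.symm.trans h') (by simp)
  rw [Succ, hs]
  exact pure_apply_ne_zero_iff _ _

end step

/-! ### The attractor and the sign of the value. -/

/-- The states from which the set `W` is entered in one step, with positive probability and for
some choice of player 1, whatever player 2 chooses. -/
def pre (W : Set G.State) : Set G.State :=
  {x | (IsFriendly (G.kind x.1) ∧ ∃ w, (x.1, w) ∈ G.E ∧ ((w, x.2) : G.State) ∈ W) ∨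
    (∃ h : G.kind x.1 = some NodeType.S,
      (((G.Ord ⟨x.1, h⟩).get (x.2 ⟨x.1, h⟩), G.advance ⟨x.1, h⟩ x.2) : G.State) ∈ W) ∨
    (G.kind x.1 = some NodeType.two ∧ ∀ w, (x.1, w) ∈ G.E → ((w, x.2) : G.State) ∈ W)}

/-- The attractor of the target for the coalition of player 1 and chance, in at most `n` steps. -/
def attr : ℕ → Set G.State
  | 0 => {x | x.1 = G.t}
  | n + 1 => attr n ∪ G.pre (attr n)

theorem attr_mono : Monotone G.attr :=
  monotone_nat_of_le_succ fun _ => Set.subset_union_left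

/-- A strategy cannot depend on `n`, so one move must serve all stages: take the one given by the
least stage that contains `x`; monotonicity covers the others. -/
theorem exists_friendly_move (x : G.State) (hf : IsFriendly (G.kind x.1))
    (hx : ∃ n, x ∈ G.attr n) :
    ∃ w, (x.1, w) ∈ G.E ∧ ∀ n, x ∈ G.attr (n + 1) → ((w, x.2) : G.State) ∈ G.attr n := by
  classical
  have hm := Nat.find_spec hx
  have hmin : ∀ n, x ∈ G.attr n → Nat.find hx ≤ n := fun n => Nat.find_min' hx
  rcases h : Nat.find hx with _ | m
  · rw [h] at hm
    rw [(G.kind_eq_none_iff x.1).2 hm] at hf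
    simp [IsFriendly] at hf
  · rw [h] at hm
    rcases hm with hm | ⟨-, w, hw, hm⟩ | ⟨hS, -⟩ | ⟨h2, -⟩
    · have := hmin m hm; omega
    · refine ⟨w, hw, fun n hn => G.attr_mono ?_ hm⟩
      have := hmin _ hn; omega
    · rw [hS] at hf; simp [IsFriendly] at hf
    · rw [h2] at hf; simp [IsFriendly] at hf

/-- If all successors had ranks, their maximum over the finite vertex set would bound the rank of
`x`. -/
theorem exists_escape (x : G.State) (h2 : G.kind x.1 = some NodeType.two)
    (hx : ¬ ∃ n, x ∈ G.attr n) :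
    ∃ w, (x.1, w) ∈ G.E ∧ ¬ ∃ n, ((w, x.2) : G.State) ∈ G.attr n := by
  by_contra! h
  choose! f hf using h
  refine hx ⟨Finset.univ.sup f + 1, Or.inr (Or.inr (Or.inr ⟨h2, fun w hw => ?_⟩))⟩
  exact G.attr_mono (Finset.le_sup (Finset.mem_univ w)) (hf w hw)

open Classical in
/-- An attractor strategy of player 1. -/
noncomputable def attractorStrategy : G.Strategy NodeType.one := fun x =>
  if hx : ∃ n, ((x.1.1, x.2) : G.State) ∈ G.attr n then
    ⟨(G.exists_friendly_move (x.1.1, x.2) (Or.inr x.1.2) hx).choose,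
      (G.exists_friendly_move (x.1.1, x.2) (Or.inr x.1.2) hx).choose_spec.1⟩
  else Classical.arbitrary (G.Strategy NodeType.one) x

open Classical in
/-- A strategy of player 2 that avoids the attractor. -/
noncomputable def escapeStrategy : G.Strategy NodeType.two := fun x =>
  if hx : ∃ n, ((x.1.1, x.2) : G.State) ∈ G.attr n then
    Classical.arbitrary (G.Strategy NodeType.two) x
  else
    ⟨(G.exists_escape (x.1.1, x.2) x.1.2 hx).choose,
      (G.exists_escape (x.1.1, x.2) x.1.2 hx).choose_spec.1⟩

theorem exists_reach_of_mem_attr (τ : G.Strategy NodeType.two) (n : ℕ) (x : G.State)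
    (hx : x ∈ G.attr n) :
    ∃ y : G.State, ReflTransGen (G.Succ G.attractorStrategy τ) x y ∧ y.1 = G.t := by
  induction n generalizing x with
  | zero => exact ⟨x, .refl, hx⟩
  | succ n ih =>
    -- The disjunction lies under the quantifier; when `x` is already in the earlier stage, `y` is a
    -- dummy.
    suffices h : ∃ y, G.Succ G.attractorStrategy τ x y ∧ y ∈ G.attr n ∨ x ∈ G.attr n by
      obtain ⟨y, ⟨hxy, hy⟩ | hx⟩ := h
      · obtain ⟨z, hz, ht⟩ := ih y hy
        exact ⟨z, .head hxy hz, ht⟩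
      · exact ih x hx
    rcases id hx with h | ⟨hf, w, hw, h⟩ | ⟨hS, h⟩ | ⟨h2, h⟩
    · exact ⟨x, Or.inr h⟩
    · rcases hf with hR | h1
      · exact ⟨(w, x.2), Or.inl ⟨(succ_iff_of_R hR).2 ⟨hw, rfl⟩, h⟩⟩
      · refine ⟨_, Or.inl ⟨(succ_iff_of_one h1).2 rfl, ?_⟩⟩
        have hx' : ∃ n, ((x.1, x.2) : G.State) ∈ G.attr n := ⟨n + 1, hx⟩
        simp only [attractorStrategy, dif_pos hx']
        exact (G.exists_friendly_move (x.1, x.2) (Or.inr h1) hx').choose_spec.2 n hx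
    · exact ⟨_, Or.inl ⟨(succ_iff_of_S hS).2 rfl, h⟩⟩
    · exact ⟨_, Or.inl ⟨(succ_iff_of_two h2).2 rfl, h _ (τ (⟨x.1, h2⟩, x.2)).2⟩⟩

/-- The complement of the attractor is a trap: at a node of type `R`, `S` or `1`, a successor in the
attractor would draw `x` in as well. -/
theorem not_mem_attr_of_succ (σ : G.Strategy NodeType.one) {x y : G.State}
    (hx : ¬ ∃ n, x ∈ G.attr n) (hxy : G.Succ σ G.escapeStrategy x y) :
    ¬ ∃ n, y ∈ G.attr n := by
  rcases h : G.kind x.1 with _ | _ | _ | _ | _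
  · rw [(succ_iff_of_none h).1 hxy]; exact hx
  · obtain ⟨hE, h2⟩ := (succ_iff_of_R h).1 hxy
    rintro ⟨n, hn⟩
    refine hx ⟨n + 1, Or.inr (Or.inl ⟨Or.inl h, y.1, hE, ?_⟩)⟩
    rw [← h2]; exact hn
  · rintro ⟨n, hn⟩
    refine hx ⟨n + 1, Or.inr (Or.inr (Or.inl ⟨h, ?_⟩))⟩
    rw [← (succ_iff_of_S h).1 hxy]; exact hn
  · rintro ⟨n, hn⟩
    rw [(succ_iff_of_one h).1 hxy] at hn
    exact hx ⟨n + 1, Or.inr (Or.inl ⟨Or.inr h, _, (σ (⟨x.1, h⟩, x.2)).2, hn⟩)⟩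
  · rw [(succ_iff_of_two h).1 hxy]
    have hx' : ¬ ∃ n, ((x.1, x.2) : G.State) ∈ G.attr n := hx
    simp only [escapeStrategy, dif_neg hx']
    exact (G.exists_escape (x.1, x.2) h hx').choose_spec.2

theorem val_pos_iff : 0 < G.val ↔ ∃ n, G.initialState ∈ G.attr n := by
  constructor
  · intro hv
    by_contra hI
    refine hv.ne' (le_antisymm (iSup_le fun σ => ?_) zero_le)
    refine (iInf_le _ G.escapeStrategy).trans (le_of_eq ?_)
    by_contra hne
    obtain ⟨x, hr, ht⟩ := (G.playMeasure_reach_pos_iff σ _).1 (pos_iff_ne_zero.2 hne)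
    have hn : ¬ ∃ n, x ∈ G.attr n := by
      clear ht
      induction hr with
      | refl => exact hI
      | tail _ h ih => exact G.not_mem_attr_of_succ σ ih h
    exact hn ⟨0, ht⟩
  · rintro ⟨n, hn⟩
    -- There are finitely many strategies, so the infimum of these positive numbers is attained and
    -- is itself positive.
    obtain ⟨τ, hτ⟩ := exists_eq_ciInf_of_finite
      (f := fun τ => G.playMeasure G.attractorStrategy τ G.Reach)
    have hpos := (G.playMeasure_reach_pos_iff G.attractorStrategy τ).2
      (G.exists_reach_of_mem_attr τ n _ hn)
    exact hpos.trans_le (hτ.le.trans (le_iSup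
      (fun σ => ⨅ τ, G.playMeasure σ τ G.Reach) G.attractorStrategy))

/-! ### Games without probabilistic nodes. -/

theorem exists_succ_unique (hR : ∀ v, G.kind v ≠ some NodeType.R)
    (σ : G.Strategy NodeType.one) (τ : G.Strategy NodeType.two) (x : G.State) :
    ∃ y, ∀ z, G.Succ σ τ x z → z = y := by
  rcases h : G.kind x.1 with _ | _ | _ | _ | _
  · exact ⟨_, fun z => (succ_iff_of_none h).1⟩
  · exact absurd h (hR _)
  · exact ⟨_, fun z => (succ_iff_of_S h).1⟩
  · exact ⟨_, fun z => (succ_iff_of_one h).1⟩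
  · exact ⟨_, fun z => (succ_iff_of_two h).1⟩

theorem law_ne_zero_unique (hR : ∀ v, G.kind v ≠ some NodeType.R)
    (σ : G.Strategy NodeType.one) (τ : G.Strategy NodeType.two) (i : ℕ) (x y : G.State)
    (hx : G.law σ τ i {x} ≠ 0) (hy : G.law σ τ i {y} ≠ 0) : x = y := by
  induction i generalizing x y with
  | zero =>
    have h : ∀ z, G.law σ τ 0 {z} ≠ 0 → z = G.initialState := by
      intro z hz
      by_contra hne
      exact hz (by simp [law_zero, Ne.symm hne])
    rw [h x hx, h y hy]
  | succ i ih =>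
    obtain ⟨a, ha, hax⟩ := (G.law_succ_ne_zero_iff σ τ i x).1 hx
    obtain ⟨b, hb, hby⟩ := (G.law_succ_ne_zero_iff σ τ i y).1 hy
    obtain rfl := ih a b ha hb
    obtain ⟨z, hz⟩ := G.exists_succ_unique hR σ τ a
    rw [hz x hax, hz y hby]

/-- Without probabilistic nodes the value is `0` or `1`. -/
theorem val_eq_one_iff (hR : ∀ v, G.kind v ≠ some NodeType.R) : G.val = 1 ↔ 0 < G.val := by
  refine ⟨fun h => h ▸ one_pos, fun h => ?_⟩
  obtain ⟨σ, -, τ, hτ⟩ := G.val_attained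
  rw [← hτ] at h ⊢
  obtain ⟨i, x, hx, hi⟩ := (G.playMeasure_reach_ne_zero_iff σ τ).1 h.ne'
  -- The law at time `i` has only one atom, so it is concentrated at `x`, which lies over `t`.
  have hc : G.law σ τ i {x}ᶜ = 0 := by
    rw [← Set.biUnion_of_singleton ({x}ᶜ : Set G.State),
      measure_biUnion_null_iff (Set.to_countable _)]
    intro y hy
    by_contra hne
    exact hy (G.law_ne_zero_unique hR σ τ i y x hne hi)
  have h1 := (prob_compl_eq_zero_iff (measurableSet_singleton x)).1 hc
  refine le_antisymm prob_le_one (h1.symm.le.trans ?_)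
  rw [law_singleton]
  exact measure_mono fun π hπ => ⟨i, by rw [show π i = x from hπ, hx]⟩

/-! ### Invariance of the attractor under relabelling. -/

variable {G} {G' : ArrivalGame V}

/-- The first clause of `pre` does not distinguish the types `R` and `1`. Positions of the two games
have different types, hence they are compared as numbers. -/
theorem SameArena.mem_attr (h : SameArena G G') (n : ℕ) (x : G.State) (x' : G'.State)
    (h1 : x.1 = x'.1) (h2 : ∀ v hv hv', (x.2 ⟨v, hv⟩ : ℕ) = x'.2 ⟨v, hv'⟩)
    (hx : x ∈ G.attr n) : x' ∈ G'.attr n := by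
  induction n generalizing x x' with
  | zero => exact h1.symm.trans (Eq.trans hx h.t)
  | succ n ih =>
    obtain ⟨v, q⟩ := x
    obtain ⟨v', q'⟩ := x'
    dsimp only at h1 h2
    subst h1
    rcases hx with hx | ⟨hf, w, hw, hx⟩ | ⟨hS, hx⟩ | ⟨h2', hx⟩
    · exact Or.inl (ih _ _ rfl h2 hx)
    · exact Or.inr (Or.inl ⟨h.isFriendly hf, w, h.E ▸ hw, ih _ _ rfl h2 hx⟩)
    · have hS' : G'.kind v = some NodeType.S := h.kind_eq hS (by simp [IsFriendly])
      refine Or.inr (Or.inr (Or.inl ⟨hS', ih _ _ ?_ ?_ hx⟩))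
      · simp only [List.get_eq_getElem]
        congr 1
        · exact h.Ord v hS hS'
        · exact h2 v hS hS'
      · intro u hu hu'
        by_cases huv : u = v
        · subst huv
          simp only [advance, Function.update_self]
          rw [h2 u hu hu', h.Ord u hu hu']
        · have hne : (⟨u, hu⟩ : {v // G.kind v = some NodeType.S}) ≠ ⟨v, hS⟩ := by simpa using huv
          have hne' : (⟨u, hu'⟩ : {v // G'.kind v = some NodeType.S}) ≠ ⟨v, hS'⟩ := by
            simpa using huv
          simp only [advance]
          rw [Function.update_of_ne hne, Function.update_of_ne hne']
          exact h2 u hu hu'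
    · refine Or.inr (Or.inr (Or.inr ⟨h.kind_eq h2' (by simp [IsFriendly]), fun w hw => ?_⟩))
      exact ih _ _ rfl h2 (hx w (h.E ▸ hw))

theorem SameArena.val_pos_iff (h : SameArena G G') : 0 < G.val ↔ 0 < G'.val := by
  rw [G.val_pos_iff, G'.val_pos_iff]
  exact exists_congr fun n => ⟨h.mem_attr n _ _ h.s (fun _ _ _ => rfl),
    h.symm.mem_attr n _ _ h.s.symm (fun _ _ _ => rfl)⟩

end ArrivalGame

/-! ## The relabelled game -/

namespace ArrivalMachine

theorem length_halves (m : ℕ) : (halves m).length = m := by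
  induction m with
  | zero => rfl
  | succ m ih => rw [halves, List.length_cons, ih]

theorem length_dyadic (k : ℕ) : (dyadic k).length = k := by
  cases k with
  | zero => rfl
  | succ m => rw [dyadic, List.length_cons, length_halves]

/-- The repeated smallest term collapses: `2⁻⁽ᵐ⁺¹⁾ + 2⁻⁽ᵐ⁺¹⁾ = 2⁻ᵐ`. -/
theorem sum_halves (m : ℕ) : (2 ^ m)⁻¹ + (halves m).sum = 1 := by
  induction m with
  | zero => simp [halves]
  | succ m ih =>
    rw [halves, List.sum_cons, ← add_assoc, ← ih]
    congr 1
    rw [pow_succ, mul_inv, ← mul_add, ← two_mul]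
    simp

theorem sum_dyadic {k : ℕ} (hk : k ≠ 0) : (dyadic k).sum = 1 := by
  obtain ⟨m, rfl⟩ := Nat.exists_eq_succ_of_ne_zero hk
  exact sum_halves m

theorem pos_of_mem_halves {m : ℕ} {p : ℚ≥0} (hp : p ∈ halves m) : 0 < p := by
  induction m with
  | zero => simp [halves] at hp
  | succ m ih =>
    rcases List.mem_cons.1 hp with rfl | hp
    · positivity
    · exact ih hp

theorem pos_of_mem_dyadic {k : ℕ} {p : ℚ≥0} (hp : p ∈ dyadic k) : 0 < p := by
  cases k with
  | zero => simp [dyadic] at hp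
  | succ m =>
    rcases List.mem_cons.1 hp with rfl | hp
    · positivity
    · exact pos_of_mem_halves hp

theorem map_getD_idxOf {α β : Type} [DecidableEq α] (l : List α) (hl : l.Nodup) (L : List β)
    (h : l.length = L.length) (b : β) : l.map (fun a => L.getD (l.idxOf a) b) = L := by
  refine List.ext_getElem (by simpa using h) fun i h₁ h₂ => ?_
  simp only [List.length_map] at h₁
  rw [List.getElem_map, hl.idxOf_getElem i h₁, List.getD_eq_getElem _ _ h₂]

end ArrivalMachine

namespace ArrivalGame

open ArrivalMachine ArrivalEncoding

variable {n : ℕ} (G : ArrivalGame (Fin n)) (gen : Bool)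

theorem mem_outList (v w : Fin n) : w ∈ outList G v ↔ (v, w) ∈ G.E := by
  simp [outList]

theorem nodup_outList (v : Fin n) : (outList G v).Nodup :=
  (List.nodup_finRange n).filter _

/-- Positive dyadic probabilities for the out-neighbours of `v`. -/
def dyadicProb (v w : Fin n) : ℚ≥0 :=
  (dyadic (outList G v).length).getD ((outList G v).idxOf w) 0

theorem map_dyadicProb (v : Fin n) :
    (outList G v).map (dyadicProb G v) = dyadic (outList G v).length :=
  map_getD_idxOf _ (G.nodup_outList v) _ (length_dyadic _).symm 0

/-- For a non-neighbour `idxOf` is the length of the list, where `getD` returns the default `0`; all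
listed values are positive. -/
theorem dyadicProb_pos_iff (v w : Fin n) : 0 < dyadicProb G v w ↔ (v, w) ∈ G.E := by
  rw [← mem_outList]
  constructor
  · intro h
    by_contra hw
    rw [dyadicProb, List.idxOf_eq_length hw, List.getD_eq_default _ _ (length_dyadic _).le] at h
    exact h.false
  · intro hw
    refine pos_of_mem_dyadic (k := (outList G v).length) ?_
    rw [← map_dyadicProb]
    exact List.mem_map_of_mem hw

theorem sum_dyadicProb (v : Fin n) : ∑ w, dyadicProb G v w = 1 := by
  have h : ∑ w ∈ (outList G v).toFinset, dyadicProb G v w = ∑ w, dyadicProb G v w := by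
    refine Finset.sum_subset (Finset.subset_univ _) fun w _ hw => ?_
    rw [List.mem_toFinset, mem_outList, ← dyadicProb_pos_iff] at hw
    simpa using hw
  rw [← h, List.sum_toFinset _ (G.nodup_outList v), map_dyadicProb]
  refine sum_dyadic fun h0 => ?_
  obtain ⟨w, hw⟩ := G.exists_out v
  rw [← mem_outList, List.length_eq_zero_iff.1 h0] at hw
  simp at hw

/-- The new type of a vertex. -/
def relabelKind (k : Option NodeType) : Option NodeType :=
  if IsFriendly k then some (newKind gen) else k

variable {gen}

theorem isFriendly_newKind : IsFriendly (some (newKind gen)) := by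
  cases gen <;> simp [IsFriendly, newKind]

theorem relabelKind_eq_none_iff {k : Option NodeType} : relabelKind gen k = none ↔ k = none := by
  unfold relabelKind
  split_ifs with h
  · simp only [false_iff]
    rintro rfl
    simp [IsFriendly] at h
  · rfl

/-- Relabelling creates no switching nodes, so the relabelled game can take its switching orders
from `G`. -/
theorem relabelKind_eq_S {k : Option NodeType} (h : relabelKind gen k = some NodeType.S) :
    k = some NodeType.S := by
  unfold relabelKind at h
  split_ifs at h with hf
  · have := isFriendly_newKind (gen := gen)
    rw [h] at this
    simp [IsFriendly] at this
  · exact h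

variable (gen)

/-- The game in which all nodes of types `R` and `1` have the type `newKind gen`. -/
def relabel : ArrivalGame (Fin n) where
  E := G.E
  s := G.s
  t := G.t
  exists_out := G.exists_out
  target_out := G.target_out
  kind v := relabelKind gen (G.kind v)
  kind_eq_none_iff v := relabelKind_eq_none_iff.trans (G.kind_eq_none_iff v)
  P v w := G.dyadicProb v.1 w
  P_sum v := G.sum_dyadicProb v.1
  P_pos_iff v w := G.dyadicProb_pos_iff v.1 w
  Ord v := G.Ord ⟨v.1, relabelKind_eq_S v.2⟩
  mem_Ord_iff v w := G.mem_Ord_iff ⟨v.1, relabelKind_eq_S v.2⟩ w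

theorem sameArena_relabel : SameArena G (G.relabel gen) where
  E := rfl
  s := rfl
  t := rfl
  kind v := by
    by_cases h : IsFriendly (G.kind v)
    · refine Or.inr ⟨h, ?_⟩
      simp only [relabel, relabelKind, if_pos h]
      exact isFriendly_newKind
    · exact Or.inl (by simp only [relabel, relabelKind, if_neg h])
  Ord _ _ _ := rfl

/-- This ties the machine, which acts on words, to the relabelled game. -/
theorem record_relabel (v : Fin n) :
    record (G.relabel gen) v = relabelRecord gen (record G v) := by
  by_cases h : IsFriendly (G.kind v)
  · have hk : (G.relabel gen).kind v = some (newKind gen) := if_pos h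
    have hS : G.kind v ≠ some NodeType.S := by
      intro e; rw [e] at h; simp [IsFriendly] at h
    have hS' : some (newKind gen) ≠ some NodeType.S := by
      cases gen <;> simp [newKind]
    have hout : outList (G.relabel gen) v = outList G v := rfl
    simp only [record, relabelRecord, if_pos h, dif_neg hS, dif_neg hS', hout, hk, List.length_map]
    congr 3
    cases gen
    -- The counter stays at `0`, and `dyadic 0` is the empty list that a node of player 1 requires.
    · simp [newKind, dyadic]
    · simp only [newKind, if_true, dite_true, Bool.toNat_true, one_mul]
      exact G.map_dyadicProb v
  · have hk : (G.relabel gen).kind v = G.kind v := if_neg h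
    have hR : G.kind v ≠ some NodeType.R := fun e => h (Or.inl e)
    have hout : outList (G.relabel gen) v = outList G v := rfl
    have hr : relabelRecord gen (record G v) = record G v := if_neg h
    rw [hr]
    simp only [record, dif_neg hR, hout, hk]
    rfl

end ArrivalGame

namespace ArrivalInstance

open ArrivalMachine ArrivalEncoding

/-- The relabelled instance. -/
def relabel (gen : Bool) {B B' : Set NodeType} (hg : newKind gen ∈ B')
    (hB : ∀ c ∈ B, ¬ IsFriendly (some c) → c ∈ B') (I : ArrivalInstance B) :
    ArrivalInstance B' where
  n := I.n
  game := I.game.relabel gen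
  kind_mem v c hc := by
    change (if IsFriendly (I.game.kind v) then some (newKind gen) else I.game.kind v) = some c at hc
    split_ifs at hc with h
    · rwa [← Option.some.inj hc]
    · exact hB c (I.kind_mem v c hc) (hc ▸ h)

theorem nonempty_computable_relabel (gen : Bool) {B B' : Set NodeType} (hg : newKind gen ∈ B')
    (hB : ∀ c ∈ B, ¬ IsFriendly (some c) → c ∈ B') :
    Nonempty (Turing.TM2ComputableInPolyTime (instanceCode (B := B)) (instanceCode (B := B'))
      (relabel gen hg hB)) := by
  refine nonempty_computable (gen := gen) _ _ _ fun I =>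
    ⟨I.game.s, I.game.t, List.ofFn (record I.game), rfl, ?_⟩
  have h : (List.ofFn (record I.game)).map (relabelRecord gen) =
      List.ofFn (record (I.game.relabel gen)) := by
    rw [List.map_ofFn]
    exact congrArg List.ofFn (funext fun v => (I.game.record_relabel gen v).symm)
  rw [h]
  rfl

end ArrivalInstance

section reductions

variable {B B' : Set NodeType}

open ArrivalMachine

theorem arrival_yes_iff (hR : NodeType.R ∉ B) (I : ArrivalInstance B) :
    (Arrival B).Yes I ↔ 0 < I.game.val :=
  I.game.val_eq_one_iff fun v hv => hR (I.kind_mem v _ hv)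

/-- All nodes of types `R` and `1` go to player 1, so `hB` concerns only the other types. In the two
reductions to `ArrivalQual0` they go to chance. -/
theorem polyTimeReducible_qual0_arrival (hR : NodeType.R ∉ B') (h1 : NodeType.one ∈ B')
    (hB : ∀ c ∈ B, ¬ IsFriendly (some c) → c ∈ B') :
    PolyTimeReducible (ArrivalQual0 B) (Arrival B') :=
  ⟨ArrivalInstance.relabel false h1 hB, ArrivalInstance.nonempty_computable_relabel false h1 hB,
    fun I => (I.game.sameArena_relabel false).val_pos_iff.trans
      (arrival_yes_iff hR (ArrivalInstance.relabel false h1 hB I)).symm⟩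

theorem polyTimeReducible_qual0_qual0 (hR : NodeType.R ∈ B')
    (hB : ∀ c ∈ B, ¬ IsFriendly (some c) → c ∈ B') :
    PolyTimeReducible (ArrivalQual0 B) (ArrivalQual0 B') :=
  ⟨ArrivalInstance.relabel true hR hB, ArrivalInstance.nonempty_computable_relabel true hR hB,
    fun I => (I.game.sameArena_relabel true).val_pos_iff⟩

theorem polyTimeReducible_arrival_qual0 (hRB : NodeType.R ∉ B) (hR : NodeType.R ∈ B')
    (hB : ∀ c ∈ B, ¬ IsFriendly (some c) → c ∈ B') :
    PolyTimeReducible (Arrival B) (ArrivalQual0 B') :=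
  ⟨ArrivalInstance.relabel true hR hB, ArrivalInstance.nonempty_computable_relabel true hR hB,
    fun I => (arrival_yes_iff hRB I).trans (I.game.sameArena_relabel true).val_pos_iff⟩

end reductions

theorem mainTheorem7 :
    PolyTimeEquivalent
      (ArrivalQual0 {NodeType.R, NodeType.S, NodeType.one, NodeType.two})
      (Arrival {NodeType.S, NodeType.one, NodeType.two}) ∧
    PolyTimeEquivalent
      (Arrival {NodeType.S, NodeType.one, NodeType.two})
      (ArrivalQual0 {NodeType.R, NodeType.S, NodeType.two}) ∧
    PolyTimeEquivalent
      (ArrivalQual0 {NodeType.R, NodeType.S, NodeType.one, NodeType.two})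
      (ArrivalQual0 {NodeType.R, NodeType.S, NodeType.two}) := by
  refine ⟨⟨polyTimeReducible_qual0_arrival ?_ ?_ ?_, polyTimeReducible_arrival_qual0 ?_ ?_ ?_⟩,
    ⟨polyTimeReducible_arrival_qual0 ?_ ?_ ?_, polyTimeReducible_qual0_arrival ?_ ?_ ?_⟩,
    ⟨polyTimeReducible_qual0_qual0 ?_ ?_, polyTimeReducible_qual0_qual0 ?_ ?_⟩⟩
  all_goals first
    | (intro c; cases c <;> simp [IsFriendly])
    | simp
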